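/- Let $d\ge 1$ be an integer, $\alpha\in(1,2)$ and $\theta\in[0,\min(2-\alpha,\alpha-1)]$. Fix a smooth function $\chi:\mathbb R^d\to\mathbb R$, compactly supported in the ball $B(0,\frac43)$, such that $\varphi(\xi):=\chi(\xi/2)-\chi(\xi)$ is supported in the annulus $B(0,\frac83)\setminus B(0,\frac34)$ and $\sum_{j\in\mathbb Z}\varphi(2^{-j}\xi)=1$ for all $\xi\neq 0$. Put $h(x):=(2\pi)^{-d}\int_{\mathbb R^d}e^{i\langle x,\xi\rangle}\varphi(\xi)\,d\xi$ and, for a function $f$ on $\mathbb R^d$ with values in a finite-dimensional complex normed space, $s\in\mathbb R$ and $p\in[1,\infty]$, $$\dot\Delta_jf(x):=2^{jd}\int_{\mathbb R^d}h(2^jy)\,f(x-y)\,dy\quad(j\in\mathbb Z),\qquad \|f\|_{\dot B^s_{p,1}}:=\sum_{j\in\mathbb Z}2^{js}\,\|\dot\Delta_jf\|_{L^p(\mathbb R^d)}\in[0,\infty].$$ Let $F$ be a finite-dimensional complex normed space (for example $\mathbb C$ or $\mathbb C^d$). Then there exists $K>0$ such that, for all Schwartz functions $u\in\mathcal S(\mathbb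 R^d;F)$ and $\sigma\in\mathcal S(\mathbb R^d;\mathbb C)$, the principal value $$I_\alpha(u,\sigma)(x):=\mathrm{pv}\int_{\mathbb R^d}\frac{u(x+y)-u(x)}{|y|^{d+\alpha}}\,\bigl(\sigma(x+y)-\sigma(x)\bigr)\,dy=\lim_{\varepsilon\to0^+}\int_{|y|>\varepsilon}\frac{u(x+y)-u(x)}{|y|^{d+\alpha}}\,\bigl(\sigma(x+y)-\sigma(x)\bigr)\,dy$$ exists for every $x\in\mathbb R^d$, and $$\|I_\alpha(u,\sigma)\|_{\dot B^{2-\alpha}_{d,1}}\le K\,\|\nabla u\|_{\dot B^{1-\theta}_{d,1}}\,\|\sigma\|_{\dot B^{1+\theta}_{d,1}}.$$ (Here $\nabla u(x)$ is the derivative of $u$ at $x$, a linear map $\mathbb R^d\to F$ measured in operator norm. Real-valued $u$ and $\sigma$ are included by viewing them as complex-valued.) -/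

import Mathlib

open MeasureTheory Filter Topology
open scoped ENNReal FourierTransform ContDiff SchwartzMap RealInnerProductSpace

noncomputable section

/-- The function `φ(ξ) = χ(ξ/2) - χ(ξ)` attached to a cut-off `χ`. -/
def lpAnnulus {d : ℕ} (χ : EuclideanSpace ℝ (Fin d) → ℝ) (ξ : EuclideanSpace ℝ (Fin d)) : ℝ :=
  χ ((2 : ℝ)⁻¹ • ξ) - χ ξ

/-- `χ` is an admissible Littlewood-Paley cut-off: smooth, compactly supported in `B(0, 4/3)`,
and such that `φ = χ(·/2) - χ` is supported in the annulus `B(0, 8/3) \ B(0, 3/4)` and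
`∑ j ∈ ℤ, φ(2^{-j} ξ) = 1` for all `ξ ≠ 0`. -/
structure IsLittlewoodPaleyCutoff {d : ℕ} (χ : EuclideanSpace ℝ (Fin d) → ℝ) : Prop where
  smooth : ContDiff ℝ ∞ χ
  tsupport_subset : tsupport χ ⊆ Metric.ball 0 (4 / 3)
  tsupport_annulus_subset :
    tsupport (lpAnnulus χ) ⊆ Metric.ball 0 (8 / 3) \ Metric.ball 0 (3 / 4)
  hasSum_one : ∀ ξ : EuclideanSpace ℝ (Fin d), ξ ≠ 0 →
    HasSum (fun j : ℤ => lpAnnulus χ ((2 : ℝ) ^ (-j) • ξ)) 1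

/-- The kernel `h = 𝓕⁻¹ φ`, where `𝓕 f(ξ) = ∫ exp(-i ⟨x, ξ⟩) f(x) dx`. In terms of Mathlib's
inverse Fourier integral (with phase `exp(2πi ⟨x, ξ⟩)`) it is `(2π)^{-d} (𝓕⁻ φ)(x / 2π)`. -/
def lpKernel {d : ℕ} (χ : EuclideanSpace ℝ (Fin d) → ℝ) (x : EuclideanSpace ℝ (Fin d)) : ℂ :=
  (((2 * Real.pi) ^ d)⁻¹ : ℝ) •
    𝓕⁻ (fun ξ : EuclideanSpace ℝ (Fin d) => (lpAnnulus χ ξ : ℂ)) ((2 * Real.pi)⁻¹ • x)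

/-- The kernel written out: `h(x) = (2π)^{-d} ∫ exp(i ⟨x, ξ⟩) φ(ξ) dξ`. -/
theorem lpKernel_eq {d : ℕ} (χ : EuclideanSpace ℝ (Fin d) → ℝ) (x : EuclideanSpace ℝ (Fin d)) :
    lpKernel χ x = (((2 * Real.pi) ^ d)⁻¹ : ℝ) •
      ∫ ξ : EuclideanSpace ℝ (Fin d), Complex.exp (⟪x, ξ⟫ * Complex.I) * (lpAnnulus χ ξ : ℂ) := by
  unfold lpKernel
  rw [Real.fourierInv_eq']
  congr 1
  refine integral_congr_ae (Eventually.of_forall fun ξ => ?_)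
  have h : 2 * Real.pi * ⟪ξ, (2 * Real.pi)⁻¹ • x⟫ = ⟪x, ξ⟫ := by
    rw [inner_smul_right, real_inner_comm]
    field_simp
  simp only [smul_eq_mul]
  rw [h]

/-- The homogeneous dyadic block `Δ_j f(x) = 2^{jd} ∫ h(2^j y) f(x - y) dy`. -/
def dyadicBlock {d : ℕ} {G : Type*} [NormedAddCommGroup G] [NormedSpace ℂ G]
    (χ : EuclideanSpace ℝ (Fin d) → ℝ) (j : ℤ) (f : EuclideanSpace ℝ (Fin d) → G)
    (x : EuclideanSpace ℝ (Fin d)) : G :=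
  (((2 : ℝ) ^ j) ^ d) • ∫ y : EuclideanSpace ℝ (Fin d), lpKernel χ ((2 : ℝ) ^ j • y) • f (x - y)

/-- The homogeneous Besov (semi)norm `‖f‖_{Ḃ^s_{p,1}} = ∑_{j ∈ ℤ} 2^{js} ‖Δ_j f‖_{L^p}`,
with values in `[0, ∞]`. -/
def besovNorm {d : ℕ} {G : Type*} [NormedAddCommGroup G] [NormedSpace ℂ G]
    (χ : EuclideanSpace ℝ (Fin d) → ℝ) (s : ℝ) (p : ℝ≥0∞)
    (f : EuclideanSpace ℝ (Fin d) → G) : ℝ≥0∞ :=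
  ∑' j : ℤ, ENNReal.ofReal ((2 : ℝ) ^ ((j : ℝ) * s)) * eLpNorm (dyadicBlock χ j f) p volume

/-- `pv ∫ f(y) dy = L`, with the singularity at the origin: `f` is integrable on `{|y| > ε}` for
every `ε > 0`, and the integrals over these sets tend to `L` as `ε → 0⁺`. -/
def HasPrincipalValue {d : ℕ} {G : Type*} [NormedAddCommGroup G] [NormedSpace ℝ G]
    (f : EuclideanSpace ℝ (Fin d) → G) (L : G) : Prop :=
  (∀ ε : ℝ, 0 < ε → IntegrableOn f {y | ε < ‖y‖} volume) ∧
    Tendsto (fun ε : ℝ => ∫ y in {y : EuclideanSpace ℝ (Fin d) | ε < ‖y‖}, f y) (𝓝[>] 0) (𝓝 L)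

/-- The integrand `y ↦ (σ(x+y) - σ(x)) (u(x+y) - u(x)) / |y|^{d+α}` of `I_α(u, σ)(x)`. -/
def nonlocalIntegrand {d : ℕ} {F : Type*} [NormedAddCommGroup F] [NormedSpace ℂ F] (α : ℝ)
    (u : EuclideanSpace ℝ (Fin d) → F) (σ : EuclideanSpace ℝ (Fin d) → ℂ)
    (x y : EuclideanSpace ℝ (Fin d)) : F :=
  (‖y‖ ^ ((d : ℝ) + α))⁻¹ • ((σ (x + y) - σ x) • (u (x + y) - u x))

/-- The nonlocal bilinear term
`I_α(u, σ)(x) = pv ∫ (u(x+y) - u(x)) (σ(x+y) - σ(x)) / |y|^{d+α} dy`. -/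
def nonlocalTerm {d : ℕ} {F : Type*} [NormedAddCommGroup F] [NormedSpace ℂ F] (α : ℝ)
    (u : EuclideanSpace ℝ (Fin d) → F) (σ : EuclideanSpace ℝ (Fin d) → ℂ)
    (x : EuclideanSpace ℝ (Fin d)) : F :=
  limUnder (𝓝[>] (0 : ℝ)) fun ε : ℝ =>
    ∫ y in {y : EuclideanSpace ℝ (Fin d) | ε < ‖y‖}, nonlocalIntegrand α u σ x y

end

set_option linter.unusedSectionVars false

/-! ### Minkowski's integral inequality -/

section Minkowski

variable {X Y : Type*} [MeasurableSpace X] [MeasurableSpace Y] {μ : Measure X} {ν : Measure Y}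

/-! Write `u = ∑ Δ_j u`, `σ = ∑ Δ_k σ` and bound each `I_α(Δ_j u, Δ_k σ)` separately, by
interpolation instead of by tracking the frequencies of the products. For a block of frequency
`2^k`, a difference with step `y` costs at most a constant times `min(1, 2^k |y|)`, and `‖u(· + y) -
u‖_p ≤ |y| ‖∇u‖_p`. Minkowski and Hölder then bound the term in `L^r` by `‖∇u‖_p ‖σ‖_q` times `∫
|y|^{1-d-α} min(1, 2^k |y|) dy`. This integral converges because `1 < α < 2`, and by scaling it is a
multiple of `2^{k(α-1)}` (`eLpNorm_nonlocalIntegral_le`, `lintegral_singularWeight`).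

A discrete Leibniz rule (`finDiff_nonlocalIntegral`) shows that differences of the term with step
`z` obey the same bound times `2^{max(j,k)} |z|`. Since `0 < 2 - α < 1`, these two bounds control
the `Ḃ^{2-α}` norm at the price of `2^{max(j,k)(2-α)}` (`tsum_eLpNorm_scaledConv_le`).

Next, Bernstein's inequality puts the factor of lower frequency in `L^∞`, at the price of `2^j` or
`2^k`, and leaves the other in `L^d`. The total exponent is `k + j` if `j ≤ k` and `j(2-α) + kα` if
`k ≤ j`. Both are at most `j(1-θ) + k(1+θ)`, by `0 ≤ θ` and `θ ≤ α - 1` respectively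
(`exists_tsum_nonlocalIntegral_le_twoPow`). The double sum over `j, k` therefore factors into the
product of the two Besov norms.

Passing from blocks to `u` and `σ` uses telescoping partial sums with uniform bounds, dominated
convergence and Fatou (`eLpNorm_scaledConv_nonlocalIntegral_le`). -/

theorem eLpNorm_top_lintegral_le [SFinite μ] [SFinite ν]
    {f : X → Y → ℝ≥0∞} (hf : Measurable (Function.uncurry f)) {A : Y → ℝ≥0∞} (hA : Measurable A)
    (h : ∀ y, eLpNorm (fun x => f x y) ∞ μ ≤ A y) :
    eLpNorm (fun x => ∫⁻ y, f x y ∂ν) ∞ μ ≤ ∫⁻ y, A y ∂ν := by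
  have h1 : ∀ y, ∀ᵐ x ∂μ, f x y ≤ A y := fun y => by
    have := enorm_ae_le_eLpNormEssSup (fun x => f x y) μ
    filter_upwards [this] with x hx
    exact (hx.trans (by simpa [eLpNorm_exponent_top] using h y))
  have h2 : ∀ᵐ x ∂μ, ∀ᵐ y ∂ν, f x y ≤ A y := by
    rw [Measure.ae_ae_comm]
    · exact Eventually.of_forall h1
    · exact measurableSet_le hf (hA.comp measurable_snd)
  rw [eLpNorm_exponent_top]
  refine eLpNormEssSup_le_of_ae_enorm_bound ?_
  filter_upwards [h2] with x hx
  exact lintegral_mono_ae hx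

/-- Hölder's inequality against the constant 1: Jensen's inequality without normalizing the measure.
-/
theorem lintegral_rpow_le_measure_univ_mul {p : ℝ} (hp : 1 ≤ p) {g : Y → ℝ≥0∞}
    (hg : AEMeasurable g ν) :
    (∫⁻ y, g y ∂ν) ^ p ≤ (ν Set.univ) ^ (p - 1) * ∫⁻ y, g y ^ p ∂ν := by
  rcases hp.eq_or_lt with rfl | hp
  · simp
  have hpq := Real.HolderConjugate.conjExponent hp
  have h := ENNReal.lintegral_mul_le_Lp_mul_Lq ν hpq hg (aemeasurable_const (b := (1 : ℝ≥0∞)))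
  simp only [Pi.mul_apply, mul_one, ENNReal.one_rpow, lintegral_one] at h
  have hp0 : 0 < p := by linarith
  calc _ ≤ ((∫⁻ y, g y ^ p ∂ν) ^ (1 / p) * (ν Set.univ) ^ (1 / p.conjExponent)) ^ p := by
        gcongr
    _ = _ := by
        rw [ENNReal.mul_rpow_of_nonneg _ _ hp0.le, ← ENNReal.rpow_mul, ← ENNReal.rpow_mul,
          one_div_mul_cancel hp0.ne', ENNReal.rpow_one, mul_comm]
        congr 2
        rw [Real.conjExponent]
        have : p - 1 ≠ 0 := by linarith
        field_simp

/-- Absorb `A` into the measure: `∫ f dν = ∫ (f / A) d(Aν)`, where `Aν` has finite mass `∫ A`.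
Jensen for `Aν` and Tonelli reduce the claim to the slices of `f / A`, whose `p`-th powers have
integral at most 1. -/
theorem lintegral_rpow_lintegral_le_of_pos [SFinite μ] [SFinite ν] {p : ℝ} (hp : 1 ≤ p)
    {f : X → Y → ℝ≥0∞} (hf : Measurable (Function.uncurry f)) {A : Y → ℝ≥0∞} (hA : Measurable A)
    (hA0 : ∀ y, A y ≠ 0) (hAi : ∫⁻ y, A y ∂ν ≠ ⊤)
    (h : ∀ y, ∫⁻ x, f x y ^ p ∂μ ≤ A y ^ p) :
    ∫⁻ x, (∫⁻ y, f x y ∂ν) ^ p ∂μ ≤ (∫⁻ y, A y ∂ν) ^ p := by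
  have hp0 : 0 < p := by linarith
  set κ := ν.withDensity A with hκ
  have hκu : κ Set.univ = ∫⁻ y, A y ∂ν := by simp [hκ]
  have hAt : ∀ᵐ y ∂ν, A y < ⊤ := ae_lt_top hA hAi
  have hfm : ∀ x, Measurable (f x) := fun x => hf.comp measurable_prodMk_left
  have hG : Measurable (Function.uncurry fun x y => f x y / A y) :=
    hf.div (hA.comp measurable_snd)
  have hfm' : ∀ y, Measurable (fun x => f x y) := fun y => hf.comp measurable_prodMk_right
  have e1 : ∀ x, ∫⁻ y, f x y ∂ν = ∫⁻ y, f x y / A y ∂κ := fun x => by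
    rw [hκ, lintegral_withDensity_eq_lintegral_mul _ hA (g := fun y => f x y / A y)
        ((hfm x).div hA)]
    refine lintegral_congr_ae ?_
    filter_upwards [hAt] with y hy
    simp only [Pi.mul_apply]
    rw [ENNReal.mul_div_cancel (hA0 y) hy.ne]
  calc ∫⁻ x, (∫⁻ y, f x y ∂ν) ^ p ∂μ
      ≤ ∫⁻ x, (κ Set.univ) ^ (p - 1) * ∫⁻ y, (f x y / A y) ^ p ∂κ ∂μ := by
        refine lintegral_mono fun x => ?_
        simp only [e1]
        exact lintegral_rpow_le_measure_univ_mul hp ((hfm x).div hA).aemeasurable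
    _ = (κ Set.univ) ^ (p - 1) * ∫⁻ x, ∫⁻ y, (f x y / A y) ^ p ∂κ ∂μ := by
        rw [lintegral_const_mul]
        exact (hG.pow_const p).lintegral_prod_right'
    _ = (κ Set.univ) ^ (p - 1) * ∫⁻ y, ∫⁻ x, (f x y / A y) ^ p ∂μ ∂κ := by
        rw [lintegral_lintegral_swap (hG.pow_const p).aemeasurable]
    _ ≤ (κ Set.univ) ^ (p - 1) * ∫⁻ y, 1 ∂κ := by
        gcongr with y
        simp_rw [div_eq_mul_inv, ENNReal.mul_rpow_of_nonneg _ _ hp0.le]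
        rw [lintegral_mul_const _ ((hfm' y).pow_const p), ENNReal.inv_rpow]
        exact (mul_le_mul_left (h y) _).trans (ENNReal.mul_inv_le_one _)
    _ = (∫⁻ y, A y ∂ν) ^ p := by
        rw [lintegral_one, hκu]
        by_cases h0 : ∫⁻ y, A y ∂ν = 0
        · simp [h0, hp0]
        · nth_rewrite 2 [← ENNReal.rpow_one (∫⁻ y, A y ∂ν)]
          rw [← ENNReal.rpow_add _ _ h0 hAi]
          congr 1; ring

/-- **Minkowski's integral inequality**. -/
theorem eLpNorm_lintegral_le [SFinite μ] [SigmaFinite ν] {p : ℝ≥0∞} (hp : 1 ≤ p)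
    {f : X → Y → ℝ≥0∞} (hf : Measurable (Function.uncurry f)) {A : Y → ℝ≥0∞} (hA : Measurable A)
    (h : ∀ y, eLpNorm (fun x => f x y) p μ ≤ A y) :
    eLpNorm (fun x => ∫⁻ y, f x y ∂ν) p μ ≤ ∫⁻ y, A y ∂ν := by
  rcases eq_or_ne p ∞ with rfl | hpt
  · exact eLpNorm_top_lintegral_le hf hA h
  have hp0 : p ≠ 0 := (zero_lt_one.trans_le hp).ne'
  have hp1 : 1 ≤ p.toReal := by
    simpa using ENNReal.toReal_mono hpt hp
  have hpp : 0 < p.toReal := by linarith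
  rcases eq_or_ne (∫⁻ y, A y ∂ν) ⊤ with hi | hi
  · simp [hi]
  refine ENNReal.le_of_forall_pos_le_add fun ε hε _ => ?_
  -- `A` may vanish, so division by it is not allowed; a strictly positive `g` of integral below `ε`
  -- is added to it.
  obtain ⟨g, hg0, hgm, hgε⟩ := exists_pos_lintegral_lt_of_sigmaFinite ν
    (ε := ε) (by exact_mod_cast hε.ne')
  have hsum : ∫⁻ y, (A y + g y) ∂ν = ∫⁻ y, A y ∂ν + ∫⁻ y, g y ∂ν := lintegral_add_left hA _
  have key := lintegral_rpow_lintegral_le_of_pos (μ := μ) (ν := ν) hp1 hf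
    (A := fun y => A y + g y) (hA.add hgm.coe_nnreal_ennreal)
    (fun y => by simp [(hg0 y).ne'])
    (by rw [hsum]; exact ENNReal.add_ne_top.2 ⟨hi, (hgε.trans ENNReal.coe_lt_top).ne⟩)
    (fun y => by
      have := (h y).trans (le_self_add (b := (g y : ℝ≥0∞)))
      rw [eLpNorm_eq_lintegral_rpow_enorm_toReal hp0 hpt] at this
      simpa [one_div, ENNReal.rpow_inv_le_iff hpp] using this)
  rw [eLpNorm_eq_lintegral_rpow_enorm_toReal hp0 hpt, one_div, ENNReal.rpow_inv_le_iff hpp]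
  refine (le_trans (by simp) key).trans ?_
  gcongr
  rw [hsum]
  gcongr

end Minkowski

/-! ### Bounded continuously differentiable functions and finite differences -/

section Differences

variable {E G : Type*} [NormedAddCommGroup E] [InnerProductSpace ℝ E] [FiniteDimensional ℝ E]
  [MeasurableSpace E] [BorelSpace E] [NormedAddCommGroup G]

/-- The finite difference `x ↦ f (x + z) - f x`. -/
def finDiff (z : E) (f : E → G) (x : E) : G := f (x + z) - f x

theorem Continuous.finDiff {f : E → G} (hf : Continuous f) (z : E) : Continuous (finDiff z f) := by
  unfold _root_.finDiff; fun_prop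

theorem norm_finDiff_le {f : E → G} {C : ℝ} (hf : ∀ x, ‖f x‖ ≤ C) (z x : E) :
    ‖finDiff z f x‖ ≤ C + C :=
  (norm_sub_le _ _).trans (add_le_add (hf _) (hf _))

theorem eLpNorm_comp_add_right {f : E → G} (hf : Continuous f) (p : ℝ≥0∞) (a : E) :
    eLpNorm (fun x => f (x + a)) p volume = eLpNorm f p volume :=
  eLpNorm_comp_measurePreserving (p := p) hf.aestronglyMeasurable
    (measurePreserving_add_right (volume : Measure E) a)

theorem eLpNorm_finDiff_le {f : E → G} (hf : Continuous f) {p : ℝ≥0∞} (hp : 1 ≤ p) (z : E) :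
    eLpNorm (finDiff z f) p volume ≤ 2 * eLpNorm f p volume := by
  refine (eLpNorm_sub_le (f := fun x => f (x + z)) (by fun_prop : Continuous _).aestronglyMeasurable
    hf.aestronglyMeasurable hp).trans ?_
  rw [eLpNorm_comp_add_right hf, two_mul]

variable [NormedSpace ℝ G]

/-- `w` is bounded and continuously differentiable with bounded derivative `W`. -/
structure IsBoundedC1 (w : E → G) (W : E → E →L[ℝ] G) : Prop where
  hasFDerivAt : ∀ x, HasFDerivAt w (W x) x
  continuous_deriv : Continuous W
  bdd : ∃ C, ∀ x, ‖w x‖ ≤ C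
  bdd_deriv : ∃ C, ∀ x, ‖W x‖ ≤ C

namespace IsBoundedC1

variable {w : E → G} {W : E → E →L[ℝ] G}

theorem continuous (h : IsBoundedC1 w W) : Continuous w :=
  continuous_iff_continuousAt.2 fun x => (h.hasFDerivAt x).continuousAt

theorem comp_add_right (h : IsBoundedC1 w W) (z : E) :
    IsBoundedC1 (fun x => w (x + z)) (fun x => W (x + z)) where
  hasFDerivAt x := (hasFDerivAt_comp_add_right z).2 (h.hasFDerivAt (x + z))
  continuous_deriv := h.continuous_deriv.comp (by fun_prop)
  bdd := h.bdd.imp fun C hC x => hC _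
  bdd_deriv := h.bdd_deriv.imp fun C hC x => hC _

theorem sub (h : IsBoundedC1 w W) {v : E → G} {V : E → E →L[ℝ] G} (h' : IsBoundedC1 v V) :
    IsBoundedC1 (fun x => w x - v x) (fun x => W x - V x) where
  hasFDerivAt x := (h.hasFDerivAt x).sub (h'.hasFDerivAt x)
  continuous_deriv := h.continuous_deriv.sub h'.continuous_deriv
  bdd := by
    obtain ⟨C, hC⟩ := h.bdd
    obtain ⟨D, hD⟩ := h'.bdd
    exact ⟨C + D, fun x => (norm_sub_le _ _).trans (add_le_add (hC x) (hD x))⟩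
  bdd_deriv := by
    obtain ⟨C, hC⟩ := h.bdd_deriv
    obtain ⟨D, hD⟩ := h'.bdd_deriv
    exact ⟨C + D, fun x => (norm_sub_le _ _).trans (add_le_add (hC x) (hD x))⟩

theorem finDiff (h : IsBoundedC1 w W) (z : E) : IsBoundedC1 (finDiff z w) (_root_.finDiff z W) :=
  (h.comp_add_right z).sub h

theorem norm_sub_le_of_bound (h : IsBoundedC1 w W) {C : ℝ} (hC : ∀ x, ‖W x‖ ≤ C) (x y : E) :
    ‖w (x + y) - w x‖ ≤ C * ‖y‖ := by
  have := convex_univ.norm_image_sub_le_of_norm_hasFDerivWithin_le (C := C)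
    (fun z _ => (h.hasFDerivAt z).hasFDerivWithinAt) (fun z _ => hC z) (Set.mem_univ x)
    (Set.mem_univ (x + y))
  simpa using this

/-- The mean value inequality in `L^p`. -/
theorem eLpNorm_finDiff_le [CompleteSpace G] (h : IsBoundedC1 w W) {p : ℝ≥0∞} (hp : 1 ≤ p)
    (y : E) :
    eLpNorm (_root_.finDiff y w) p volume ≤ ‖y‖ₑ * eLpNorm W p volume := by
  have hc := h.continuous_deriv
  -- Integrating the derivative along the segment writes the difference as an average of translates
  -- of `W`, all with the same `L^p` norm.
  have e : ∀ x, _root_.finDiff y w x = ∫ t in (0 : ℝ)..1, W (x + t • y) y := fun x => by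
    rw [intervalIntegral.integral_eq_sub_of_hasDerivAt (f := fun t : ℝ => w (x + t • y))]
    · simp [_root_.finDiff]
    · intro t _
      have h1 : HasDerivAt (fun t : ℝ => x + t • y) y t := by
        simpa using ((hasDerivAt_id t).smul_const y).const_add x
      exact (h.hasFDerivAt (x + t • y)).comp_hasDerivAt t h1
    · exact (by fun_prop : Continuous fun t : ℝ => W (x + t • y) y).intervalIntegrable _ _
  have hm : Continuous (Function.uncurry fun (x : E) (t : ℝ) => W (x + t • y) y) := by
    simp only [Function.uncurry_def]; fun_prop
  calc eLpNorm (_root_.finDiff y w) p volume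
      ≤ eLpNorm (fun x => ∫⁻ t in Set.Ioc (0 : ℝ) 1, ‖W (x + t • y) y‖ₑ) p volume := by
        refine eLpNorm_mono_enorm fun x => ?_
        rw [e, intervalIntegral.integral_of_le zero_le_one, enorm_eq_self]
        exact enorm_integral_le_lintegral_enorm _
    _ ≤ ∫⁻ t in Set.Ioc (0 : ℝ) 1, ‖y‖ₑ * eLpNorm W p volume := by
        refine eLpNorm_lintegral_le hp hm.enorm.measurable measurable_const fun t => ?_
        rw [eLpNorm_enorm, ← eLpNorm_comp_add_right hc p (t • y)]
        have : eLpNorm (fun x => W (x + t • y) y) p volume ≤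
            eLpNorm (‖y‖ • fun x => W (x + t • y)) p volume := by
          refine eLpNorm_mono fun x => ?_
          simp only [Pi.smul_apply, norm_smul, norm_norm]
          rw [mul_comm]
          exact ContinuousLinearMap.le_opNorm _ _
        refine this.trans (le_of_eq ?_)
        rw [eLpNorm_const_smul (‖y‖) (fun x => W (x + t • y)), enorm_norm]
    _ = ‖y‖ₑ * eLpNorm W p volume := by simp

end IsBoundedC1

/-- Minkowski's inequality for vector-valued integrals. -/
theorem eLpNorm_integral_le {Y : Type*} [MeasurableSpace Y] {ν : Measure Y} [SigmaFinite ν]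
    {p : ℝ≥0∞} (hp : 1 ≤ p) {F : E → Y → G} (hF : StronglyMeasurable (Function.uncurry F))
    {A : Y → ℝ≥0∞} (hA : Measurable A) (h : ∀ y, eLpNorm (fun x => F x y) p volume ≤ A y) :
    eLpNorm (fun x => ∫ y, F x y ∂ν) p volume ≤ ∫⁻ y, A y ∂ν := by
  refine le_trans (eLpNorm_mono_enorm (g := fun x => ∫⁻ y, ‖F x y‖ₑ ∂ν) fun x => ?_)
    (eLpNorm_lintegral_le hp hF.enorm hA fun y => ?_)
  · rw [enorm_eq_self]
    exact enorm_integral_le_lintegral_enorm _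
  · rw [eLpNorm_enorm]
    exact h y

end Differences

/-! ### Rescaled convolutions -/

section ScaledConv

variable {E G : Type*} [NormedAddCommGroup E] [InnerProductSpace ℝ E] [FiniteDimensional ℝ E]
  [MeasurableSpace E] [BorelSpace E] [NormedAddCommGroup G] [NormedSpace ℂ G]

/-- The convolution of `f` with the kernel `k` rescaled to the length `2^{-m}`. -/
noncomputable def scaledConv (k : E → ℂ) (m : ℤ) (f : E → G) (x : E) : G :=
  ∫ y, k y • f (x - (2 : ℝ) ^ (-m) • y)

theorem integrable_kernel_smul {k : E → ℂ} (hk : Integrable k) {f : E → G} (hf : Continuous f)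
    (hfb : ∃ C, ∀ x, ‖f x‖ ≤ C) : Integrable (fun y => k y • f y) := by
  obtain ⟨C, hC⟩ := hfb
  exact hk.smul_bdd C hf.aestronglyMeasurable (Eventually.of_forall hC)

theorem integrable_scaledConv {k : E → ℂ} (hk : Integrable k) (m : ℤ) {f : E → G}
    (hf : Continuous f) (hfb : ∃ C, ∀ x, ‖f x‖ ≤ C) (x : E) :
    Integrable (fun y => k y • f (x - (2 : ℝ) ^ (-m) • y)) :=
  integrable_kernel_smul hk (by fun_prop) (hfb.imp fun _ hC _ => hC _)

theorem norm_scaledConv_le {k : E → ℂ} (hk : Integrable k) (m : ℤ) {f : E → G} {C : ℝ}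
    (hC : ∀ x, ‖f x‖ ≤ C) (x : E) : ‖scaledConv k m f x‖ ≤ (∫ y, ‖k y‖) * C := by
  unfold scaledConv
  rw [← integral_mul_const]
  refine norm_integral_le_of_norm_le (hk.norm.mul_const C) (Eventually.of_forall fun y => ?_)
  rw [norm_smul]
  exact mul_le_mul_of_nonneg_left (hC _) (norm_nonneg _)

theorem continuous_scaledConv {k : E → ℂ} (hk : Integrable k) (m : ℤ) {f : E → G}
    (hf : Continuous f) (hfb : ∃ C, ∀ x, ‖f x‖ ≤ C) : Continuous (scaledConv k m f) := by
  obtain ⟨C, hC⟩ := hfb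
  refine continuous_of_dominated (bound := fun y => ‖k y‖ * C)
    (fun x => (integrable_scaledConv hk m hf ⟨C, hC⟩ x).aestronglyMeasurable)
    (fun x => Eventually.of_forall fun y => ?_) (hk.norm.mul_const C)
    (Eventually.of_forall fun y => by fun_prop)
  rw [norm_smul]
  exact mul_le_mul_of_nonneg_left (hC _) (norm_nonneg _)

/-- Differentiation under the integral. As the derivative of the convolution is the convolution of
`W`, the blocks of `∇u` are the derivatives of the blocks of `u`. -/
theorem IsBoundedC1.scaledConv {k : E → ℂ} (hk : Integrable k) (m : ℤ) {w : E → G}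
    {W : E → E →L[ℝ] G} (h : IsBoundedC1 w W) :
    IsBoundedC1 (scaledConv k m w) (_root_.scaledConv k m W) where
  hasFDerivAt x := by
    obtain ⟨C, hC⟩ := h.bdd_deriv
    refine hasFDerivAt_integral_of_dominated_of_fderiv_le (s := Set.univ)
      (F' := fun x y => k y • W (x - (2 : ℝ) ^ (-m) • y)) (bound := fun y => ‖k y‖ * C) univ_mem
      (Eventually.of_forall fun x =>
        (integrable_scaledConv hk m h.continuous h.bdd x).aestronglyMeasurable)
      (integrable_scaledConv hk m h.continuous h.bdd x)
      (integrable_scaledConv hk m h.continuous_deriv h.bdd_deriv x).aestronglyMeasurable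
      (Eventually.of_forall fun y x _ => ?_) (hk.norm.mul_const C)
      (Eventually.of_forall fun y x _ => ?_)
    · rw [norm_smul]
      exact mul_le_mul_of_nonneg_left (hC _) (norm_nonneg _)
    · exact ((hasFDerivAt_comp_sub _).2 (h.hasFDerivAt _)).const_smul (k y)
  continuous_deriv := continuous_scaledConv hk m h.continuous_deriv h.bdd_deriv
  bdd := h.bdd.imp' (fun C => (∫ y, ‖k y‖) * C) fun _ hC => norm_scaledConv_le hk m hC
  bdd_deriv := h.bdd_deriv.imp' (fun C => (∫ y, ‖k y‖) * C) fun _ hC => norm_scaledConv_le hk m hC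

theorem stronglyMeasurable_scaledConv_integrand {k : E → ℂ} (hk : Continuous k) (m : ℤ) {f : E → G}
    (hf : StronglyMeasurable f) :
    StronglyMeasurable (Function.uncurry fun x y => k y • f (x - (2 : ℝ) ^ (-m) • y)) :=
  (hk.comp continuous_snd).stronglyMeasurable.smul
    (hf.comp_measurable (by fun_prop : Continuous fun p : E × E =>
      p.1 - (2 : ℝ) ^ (-m) • p.2).measurable)

theorem stronglyMeasurable_scaledConv {k : E → ℂ} (hk : Continuous k) (m : ℤ) {f : E → G}
    (hf : StronglyMeasurable f) : StronglyMeasurable (scaledConv k m f) :=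
  (stronglyMeasurable_scaledConv_integrand hk m hf).integral_prod_right

/-- Young's inequality. -/
theorem eLpNorm_scaledConv_le {k : E → ℂ} (hk : Continuous k) (m : ℤ) {f : E → G}
    (hf : StronglyMeasurable f) {p : ℝ≥0∞} (hp : 1 ≤ p) :
    eLpNorm (scaledConv k m f) p volume ≤ (∫⁻ y, ‖k y‖ₑ) * eLpNorm f p volume := by
  rw [← lintegral_mul_const _ hk.enorm.measurable]
  refine eLpNorm_integral_le hp (stronglyMeasurable_scaledConv_integrand hk m hf)
    (hk.enorm.measurable.mul_const _) fun y => ?_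
  have : (fun x => k y • f (x - (2 : ℝ) ^ (-m) • y)) =
    k y • fun x => f (x - (2 : ℝ) ^ (-m) • y) := rfl
  rw [this, eLpNorm_const_smul]
  gcongr
  exact (eLpNorm_comp_measurePreserving (p := p) hf.aestronglyMeasurable
    (measurePreserving_sub_right (volume : Measure E) ((2 : ℝ) ^ (-m) • y))).le

theorem finDiff_scaledConv {k : E → ℂ} (hk : Integrable k) (m : ℤ) {f : E → G}
    (hf : Continuous f) (hfb : ∃ C, ∀ x, ‖f x‖ ≤ C) (z : E) :
    finDiff z (scaledConv k m f) = scaledConv k m (finDiff z f) := by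
  funext x
  simp only [finDiff, scaledConv, smul_sub]
  rw [← integral_sub (integrable_scaledConv hk m hf hfb _) (integrable_scaledConv hk m hf hfb _)]
  simp only [sub_add_eq_add_sub]

/-- Translating the integration variable moves the difference onto the kernel, where the step is
measured in units of `2^{-m}`. This is the source of every factor `min(1, 2^m |z|)`. -/
theorem finDiff_scaledConv_eq_kernel {k : E → ℂ} (hk : Integrable k) (m : ℤ)
    {f : E → G} (hf : Continuous f) (hfb : ∃ C, ∀ x, ‖f x‖ ≤ C) (z : E) :
    finDiff z (scaledConv k m f) = scaledConv (finDiff ((2 : ℝ) ^ m • z) k) m f := by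
  funext x
  have h2 : (2 : ℝ) ^ (-m) * 2 ^ m = 1 := by
    rw [← zpow_add₀ two_ne_zero]; simp
  have e : scaledConv k m f (x + z) =
      ∫ y, k (y + (2 : ℝ) ^ m • z) • f (x - (2 : ℝ) ^ (-m) • y) := by
    unfold scaledConv
    rw [← integral_add_right_eq_self _ ((2 : ℝ) ^ m • z)]
    congr 1; funext y
    rw [smul_add, smul_smul, h2, one_smul]
    congr 2; abel
  simp only [finDiff]
  rw [e]
  unfold scaledConv
  simp only [finDiff, sub_smul]
  rw [integral_sub (integrable_scaledConv (hk.comp_add_right _) m hf hfb _)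
    (integrable_scaledConv hk m hf hfb _)]

/-- Fubini. Both kernels live at the same scale, so the composite kernel is their convolution,
rescaled once. -/
theorem scaledConv_scaledConv [CompleteSpace G] {k l : E → ℂ} (hk : Integrable k)
    (hl : Integrable l) (m : ℤ)
    {f : E → G} (hf : Continuous f) (hfb : ∃ C, ∀ x, ‖f x‖ ≤ C) :
    scaledConv k m (scaledConv l m f) = scaledConv (fun w => ∫ y, k y * l (w - y)) m f := by
  funext x
  obtain ⟨C, hC⟩ := hfb
  set r : ℝ := (2 : ℝ) ^ (-m) with hr
  have e1 : ∀ y, scaledConv l m f (x - r • y) = ∫ w, l (w - y) • f (x - r • w) := fun y => by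
    unfold scaledConv
    rw [← integral_sub_right_eq_self _ y]
    congr 1; funext w
    rw [← hr, smul_sub]
    congr 2; abel
  have hint : Integrable (fun q : E × E => (k q.2 * l (q.1 - q.2)) • f (x - r • q.1))
      (volume.prod volume) := by
    have := Integrable.convolution_integrand (ContinuousLinearMap.mul ℂ ℂ) hk hl
    exact this.smul_bdd C (by fun_prop : Continuous fun q : E × E =>
      f (x - r • q.1)).aestronglyMeasurable (Eventually.of_forall fun q => hC _)
  calc scaledConv k m (scaledConv l m f) x
      = ∫ y, ∫ w, (k y * l (w - y)) • f (x - r • w) := by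
        unfold scaledConv
        congr 1; funext y
        rw [← hr]
        have := e1 y
        unfold scaledConv at this
        rw [this, ← integral_smul]
        simp only [smul_smul]
    _ = ∫ w, ∫ y, (k y * l (w - y)) • f (x - r • w) := by
        rw [integral_integral_swap]
        exact hint.swap
    _ = _ := by
        unfold scaledConv
        congr 1; funext w
        exact integral_smul_const (fun y => k y * l (w - y)) (f (x - r • w))

/-- Bernstein's inequality. -/
theorem enorm_scaledConv_le_eLpNorm {k : E → ℂ} (hk : Continuous k) (m : ℤ) {f : E → G}
    (hf : Continuous f) {p q : ℝ≥0∞} [ENNReal.HolderConjugate q p] (hp : p ≠ ⊤) (x : E) :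
    ‖scaledConv k m f x‖ₑ ≤ eLpNorm k q volume *
      (ENNReal.ofReal ((2 : ℝ) ^ (m * Module.finrank ℝ E)) ^ (1 / p).toReal *
        eLpNorm f p volume) := by
  have h0 : (2 : ℝ) ^ (-m) ≠ 0 := by positivity
  have e : eLpNorm (fun y => f (x - (2 : ℝ) ^ (-m) • y)) p volume =
      ENNReal.ofReal ((2 : ℝ) ^ (m * Module.finrank ℝ E)) ^ (1 / p).toReal *
        eLpNorm f p volume := by
    have h1 : eLpNorm (fun y => f (x - y)) p volume = eLpNorm f p volume :=
      eLpNorm_comp_measurePreserving (p := p) hf.aestronglyMeasurable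
        (Measure.measurePreserving_sub_left (volume : Measure E) x)
    rw [← h1]
    -- The dilation by `2^{-m}` pushes Lebesgue measure to `2^{mn}` times itself, where `n` is the
    -- dimension; this gives the Bernstein factor `2^{mn/p}`.
    have h2 := eLpNorm_map_measure (p := p) (μ := (volume : Measure E))
      (f := fun y : E => (2 : ℝ) ^ (-m) • y)
      (g := fun y => f (x - y)) (by fun_prop : Continuous _).aestronglyMeasurable
      (by fun_prop : Continuous _).aemeasurable
    rw [Measure.map_addHaar_smul _ h0, eLpNorm_smul_measure_of_ne_top hp, smul_eq_mul] at h2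
    rw [Function.comp_def] at h2
    rw [← h2]
    congr 3
    rw [abs_of_pos (by positivity), zpow_mul, zpow_neg, inv_pow, inv_inv, zpow_natCast]
  calc ‖scaledConv k m f x‖ₑ ≤ ∫⁻ y, ‖k y • f (x - (2 : ℝ) ^ (-m) • y)‖ₑ :=
        enorm_integral_le_lintegral_enorm _
    _ = eLpNorm (k • fun y => f (x - (2 : ℝ) ^ (-m) • y)) 1 volume := by
        rw [eLpNorm_one_eq_lintegral_enorm]; rfl
    _ ≤ eLpNorm k q volume * eLpNorm (fun y => f (x - (2 : ℝ) ^ (-m) • y)) p volume :=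
        eLpNorm_smul_le_mul_eLpNorm (by fun_prop : Continuous _).aestronglyMeasurable
          hk.aestronglyMeasurable
    _ = _ := by rw [e]

end ScaledConv

theorem tendsto_two_zpow_atTop : Tendsto (fun m : ℤ => (2 : ℝ) ^ m) atTop atTop := by
  have : (fun m : ℤ => (2 : ℝ) ^ m) = fun m : ℤ => Real.exp (Real.log 2 * m) := by
    funext m
    rw [← Real.rpow_intCast, Real.rpow_def_of_pos two_pos]
  rw [this]
  exact Real.tendsto_exp_atTop.comp
    (tendsto_intCast_atTop_atTop.const_mul_atTop (Real.log_pos one_lt_two))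

theorem tendsto_two_zpow_atBot : Tendsto (fun m : ℤ => (2 : ℝ) ^ m) atBot (𝓝 0) := by
  have : (fun m : ℤ => (2 : ℝ) ^ m) = fun m : ℤ => ((2 : ℝ) ^ (-m))⁻¹ := by
    funext m
    rw [zpow_neg, inv_inv]
  rw [this]
  exact (tendsto_two_zpow_atTop.comp tendsto_neg_atBot_atTop).inv_tendsto_atTop

/-! ### Convolution kernels with prescribed Fourier transform -/

section Kernels

variable {E G : Type*} [NormedAddCommGroup E] [InnerProductSpace ℝ E] [FiniteDimensional ℝ E]
  [MeasurableSpace E] [BorelSpace E] [NormedAddCommGroup G] [NormedSpace ℂ G]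

theorem SchwartzMap.isBoundedC1 {F : Type*} [NormedAddCommGroup F] [NormedSpace ℝ F]
    (f : 𝓢(E, F)) : IsBoundedC1 f (fderiv ℝ f) where
  hasFDerivAt _ := f.differentiableAt.hasFDerivAt
  continuous_deriv := (SchwartzMap.fderivCLM ℝ E F f).continuous
  bdd := ⟨_, fun x => SchwartzMap.norm_le_seminorm ℝ f x⟩
  bdd_deriv := ⟨_, fun x => SchwartzMap.norm_le_seminorm ℝ (SchwartzMap.fderivCLM ℝ E F f) x⟩

/-- The function whose Fourier transform, with phase `exp (-i ⟨x, ξ⟩)`, is `ψ`. -/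
noncomputable def fourierKernel (ψ : 𝓢(E, ℂ)) : 𝓢(E, ℂ) :=
  (((2 * Real.pi) ^ Module.finrank ℝ E)⁻¹ : ℝ) •
    SchwartzMap.compCLMOfContinuousLinearEquiv ℂ
      (ContinuousLinearEquiv.smulLeft (Units.mk0 (2 * Real.pi)⁻¹ (by positivity))) (𝓕⁻ ψ)

theorem fourierKernel_apply (ψ : 𝓢(E, ℂ)) (x : E) :
    fourierKernel ψ x = (((2 * Real.pi) ^ Module.finrank ℝ E)⁻¹ : ℝ) •
      𝓕⁻ (ψ : E → ℂ) ((2 * Real.pi)⁻¹ • x) := by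
  rw [← SchwartzMap.fourierInv_coe]
  rfl

theorem fourierKernel_sub (ψ η : 𝓢(E, ℂ)) :
    fourierKernel (ψ - η) = fourierKernel ψ - fourierKernel η := by
  have : (𝓕⁻ (ψ - η) : 𝓢(E, ℂ)) = 𝓕⁻ ψ - 𝓕⁻ η := 
    map_sub (FourierTransform.fourierInvCLM ℂ 𝓢(E, ℂ)) ψ η
  simp only [fourierKernel, this, map_sub, smul_sub]

theorem fourierKernel_of_comp_smul {ψ η : 𝓢(E, ℂ)} {r : ℝ} (hr : 0 < r)
    (h : ∀ ξ, η ξ = ψ (r⁻¹ • ξ)) (x : E) :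
    fourierKernel η x = (r ^ Module.finrank ℝ E) • fourierKernel ψ (r • x) := by
  have e : ∀ z, 𝓕⁻ (η : E → ℂ) z = (r ^ Module.finrank ℝ E) • 𝓕⁻ (ψ : E → ℂ) (r • z) := fun z => by
    rw [Real.fourierInv_eq', Real.fourierInv_eq', ← Measure.integral_comp_inv_smul_of_nonneg _ _
        hr.le]
    congr 1; funext ξ
    rw [h, inner_smul_left, inner_smul_right]
    simp only [map_inv₀, RCLike.conj_to_real]
    rw [inv_mul_cancel_left₀ hr.ne']
  rw [fourierKernel_apply, fourierKernel_apply, e, smul_comm r, smul_comm (r ^ _)]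

/-- Fourier inversion at frequency 0, the factor `(2π)^{-n}` cancelling the Jacobian. It gives the
Littlewood-Paley kernel mean zero and the low frequency kernel mass one. -/
theorem integral_fourierKernel (ψ : 𝓢(E, ℂ)) : ∫ x, fourierKernel ψ x = ψ 0 := by
  simp_rw [fourierKernel_apply]
  have hp : 0 ≤ 2 * Real.pi := by positivity
  rw [integral_smul, Measure.integral_comp_inv_smul_of_nonneg _ _ hp, smul_smul,
    inv_mul_cancel₀ (by positivity), one_smul]
  have : 𝓕 (𝓕⁻ ψ) 0 = ψ 0 := by simp
  rw [← this, SchwartzMap.fourier_coe, Real.fourier_eq']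
  simp [SchwartzMap.fourierInv_coe]

theorem fourierInv_mul_convolution {a b c : 𝓢(E, ℂ)} (h : ∀ ξ, c ξ = a ξ * b ξ) (w : E) :
    ∫ y, 𝓕⁻ (a : E → ℂ) y * 𝓕⁻ (b : E → ℂ) (w - y) = 𝓕⁻ (c : E → ℂ) w := by
  have h1 : SchwartzMap.convolution (ContinuousLinearMap.mul ℂ ℂ) (𝓕⁻ a) (𝓕⁻ b) = 𝓕⁻ c := by
    rw [← FourierTransform.fourierInv_fourier_eq (F := 𝓢(E, ℂ))
      (SchwartzMap.convolution (ContinuousLinearMap.mul ℂ ℂ) (𝓕⁻ a) (𝓕⁻ b)),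
      SchwartzMap.fourier_convolution]
    congr 1
    ext ξ
    simp [h]
  rw [← SchwartzMap.fourierInv_coe c, ← h1, SchwartzMap.convolution_apply,
    ← SchwartzMap.fourierInv_coe, ← SchwartzMap.fourierInv_coe]
  rfl

/-- Two normalizing factors `(2π)^{-n}` meet one Jacobian `(2π)^n`, so exactly one factor survives,
as the kernel of the product requires. -/
theorem fourierKernel_mul_convolution {a b c : 𝓢(E, ℂ)} (h : ∀ ξ, c ξ = a ξ * b ξ) (w : E) :
    ∫ y, fourierKernel a y * fourierKernel b (w - y) = fourierKernel c w := by
  have hp : 0 ≤ 2 * Real.pi := by positivity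
  simp only [fourierKernel_apply, smul_sub, ← fourierInv_mul_convolution h,
    Complex.real_smul]
  set κ : ℂ := ((((2 * Real.pi) ^ Module.finrank ℝ E)⁻¹ : ℝ) : ℂ) with hκ
  have e := Measure.integral_comp_inv_smul_of_nonneg (volume : Measure E)
    (fun y => (κ * 𝓕⁻ (a : E → ℂ) y) * (κ * 𝓕⁻ (b : E → ℂ) ((2 * Real.pi)⁻¹ • w - y))) hp
  rw [e, ← integral_const_mul, Complex.real_smul, ← integral_const_mul]
  congr 1; funext y
  have : κ * (((2 * Real.pi) ^ Module.finrank ℝ E : ℝ) : ℂ) = 1 := by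
    rw [hκ, ← Complex.ofReal_mul, inv_mul_cancel₀ (by positivity), Complex.ofReal_one]
  linear_combination (κ * 𝓕⁻ (a : E → ℂ) y * 𝓕⁻ (b : E → ℂ) ((2 * Real.pi)⁻¹ • w - y)) * this

/-- The triangle inequality serves for `|w| ≥ 1`, the mean value inequality in `L^1` for `|w| ≤ 1`.
-/
theorem SchwartzMap.exists_eLpNorm_finDiff_le (k : 𝓢(E, ℂ)) :
    ∃ C : ℝ≥0∞, C ≠ ⊤ ∧ ∀ w : E, ∫⁻ y, ‖finDiff w k y‖ₑ ≤ C * min 1 ‖w‖ₑ := by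
  refine ⟨max (2 * eLpNorm k 1 volume) (eLpNorm (fderiv ℝ k) 1 volume), ?_, fun w => ?_⟩
  · refine (max_lt (ENNReal.mul_lt_top (by simp) (k.memLp 1 volume).eLpNorm_lt_top)
      ((SchwartzMap.fderivCLM ℝ E ℂ k).memLp 1 volume).eLpNorm_lt_top).ne
  · rw [← eLpNorm_one_eq_lintegral_enorm]
    rcases le_total 1 ‖w‖ₑ with h | h
    · rw [min_eq_left h, mul_one]
      exact (eLpNorm_finDiff_le k.continuous le_rfl w).trans (le_max_left _ _)
    · rw [min_eq_right h, mul_comm]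
      refine (k.isBoundedC1.eLpNorm_finDiff_le le_rfl w).trans ?_
      gcongr
      exact le_max_right _ _

theorem eLpNorm_finDiff_scaledConv_le {k : 𝓢(E, ℂ)} {C : ℝ≥0∞}
    (hC : ∀ w : E, ∫⁻ y, ‖finDiff w k y‖ₑ ≤ C * min 1 ‖w‖ₑ) (m : ℤ) {f : E → G}
    (hf : Continuous f) (hfb : ∃ D, ∀ x, ‖f x‖ ≤ D) {p : ℝ≥0∞} (hp : 1 ≤ p) (z : E) :
    eLpNorm (finDiff z (scaledConv k m f)) p volume ≤
      C * min 1 ‖(2 : ℝ) ^ m • z‖ₑ * eLpNorm f p volume := by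
  rw [finDiff_scaledConv_eq_kernel k.integrable m hf hfb]
  refine (eLpNorm_scaledConv_le (k.continuous.finDiff _) m hf.stronglyMeasurable hp).trans ?_
  gcongr
  exact hC _

theorem tendsto_scaledConv_atTop (k : 𝓢(E, ℂ)) (hk : ∫ y, k y = 1) {f : E → G}
    (hf : Continuous f) (hfb : ∃ D, ∀ x, ‖f x‖ ≤ D) [CompleteSpace G] (x : E) :
    Tendsto (fun m : ℤ => scaledConv k m f x) atTop (𝓝 (f x)) := by
  obtain ⟨D, hD⟩ := hfb
  have e : f x = ∫ y, k y • f x := by rw [integral_smul_const, hk, one_smul]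
  rw [e]
  refine tendsto_integral_filter_of_dominated_convergence (fun y => ‖k y‖ * D)
    (Eventually.of_forall fun m =>
      (integrable_scaledConv k.integrable m hf ⟨D, hD⟩ x).aestronglyMeasurable)
    (Eventually.of_forall fun m => Eventually.of_forall fun y => ?_) (k.integrable.norm.mul_const D)
    (Eventually.of_forall fun y => ?_)
  · rw [norm_smul]
    exact mul_le_mul_of_nonneg_left (hD _) (norm_nonneg _)
  · have h2 : Tendsto (fun m : ℤ => (2 : ℝ) ^ (-m)) atTop (𝓝 0) := by
      simp_rw [zpow_neg]
      exact tendsto_two_zpow_atTop.inv_tendsto_atTop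
    have h3 : Tendsto (fun m : ℤ => x - (2 : ℝ) ^ (-m) • y) atTop (𝓝 x) := by
      simpa using (h2.smul_const y).const_sub x
    exact ((hf.tendsto x).comp h3).const_smul (k y)

/-- The kernel is bounded, so a change of variables bounds the value by a multiple of `2^{mn}
‖f‖_1`, which tends to 0 because the dimension `n` is positive. Low frequencies of an integrable
function thus disappear. -/
theorem tendsto_scaledConv_atBot (k : 𝓢(E, ℂ)) [Nontrivial E] {f : E → G}
    (hf : Integrable f) (x : E) :
    Tendsto (fun m : ℤ => scaledConv k m f x) atBot (𝓝 0) := by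
  obtain ⟨D, hD⟩ := k.isBoundedC1.bdd
  set n := Module.finrank ℝ E with hn
  have hn0 : n ≠ 0 := Module.finrank_pos.ne'
  have hb : ∀ m : ℤ, ‖scaledConv k m f x‖ ≤ D * ((2 : ℝ) ^ m) ^ n * ∫ y, ‖f y‖ := fun m => by
    have hfx : Integrable (fun y => f (x - (2 : ℝ) ^ (-m) • y)) :=
      (hf.comp_sub_left x).comp_smul (by positivity)
    refine (norm_integral_le_of_norm_le (g := fun y => D * ‖f (x - (2 : ℝ) ^ (-m) • y)‖)
      (hfx.norm.const_mul D) (Eventually.of_forall fun y => ?_)).trans ?_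
    · rw [norm_smul]
      exact mul_le_mul_of_nonneg_right (hD _) (norm_nonneg _)
    · rw [integral_const_mul, Measure.integral_comp_smul_of_nonneg volume
        (fun y => ‖f (x - y)‖) _ (hR := by positivity), integral_sub_left_eq_self (fun y => ‖f y‖),
        smul_eq_mul, mul_assoc, zpow_neg, inv_pow, inv_inv]
  refine squeeze_zero_norm hb ?_
  have h2 : Tendsto (fun m : ℤ => (2 : ℝ) ^ m) atBot (𝓝 0) := tendsto_two_zpow_atBot
  have := ((h2.pow n).const_mul D).mul_const (∫ y, ‖f y‖)
  simpa [hn0] using this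

end Kernels

/-! ### Powers of two in `[0, ∞]` -/

section TwoPow

/-- The real power `2 ^ s`, in `[0, ∞]`. -/
noncomputable def twoPow (s : ℝ) : ℝ≥0∞ := ENNReal.ofReal ((2 : ℝ) ^ s)

theorem twoPow_add (s t : ℝ) : twoPow (s + t) = twoPow s * twoPow t := by
  rw [twoPow, Real.rpow_add two_pos, ENNReal.ofReal_mul (by positivity)]; rfl

theorem twoPow_zero : twoPow 0 = 1 := by simp [twoPow]

theorem twoPow_mono {s t : ℝ} (h : s ≤ t) : twoPow s ≤ twoPow t :=
  ENNReal.ofReal_le_ofReal (Real.rpow_le_rpow_of_exponent_le one_le_two h)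

theorem ofReal_two_zpow (m : ℤ) : ENNReal.ofReal ((2 : ℝ) ^ m) = twoPow m := by
  rw [twoPow, Real.rpow_intCast]

theorem enorm_two_zpow_smul {E : Type*} [NormedAddCommGroup E] [NormedSpace ℝ E] (m : ℤ) (y : E) :
    ‖(2 : ℝ) ^ m • y‖ₑ = twoPow m * ‖y‖ₑ := by
  rw [enorm_smul, Real.enorm_eq_ofReal (by positivity), ofReal_two_zpow]

/-- Geometric series on both sides: ratio `2^{s-1}` towards `+∞` and `2^{-s}` towards `-∞`. This is
where `0 < s < 1` enters. -/
theorem tsum_twoPow_mul_min_ne_top {s : ℝ} (hs : s ∈ Set.Ioo (0 : ℝ) 1) :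
    ∑' l : ℤ, twoPow (l * s) * min 1 (twoPow (-l)) ≠ ⊤ := by
  have hg : ∀ r : ℝ, r < 0 → Summable fun n : ℕ => (2 : ℝ) ^ (n * r) := fun r hr => by
    have : (fun n : ℕ => (2 : ℝ) ^ (n * r)) = fun n : ℕ => ((2 : ℝ) ^ r) ^ n := by
      funext n
      rw [mul_comm, Real.rpow_mul zero_le_two, Real.rpow_natCast]
    rw [this]
    exact summable_geometric_of_lt_one (by positivity)
      (Real.rpow_lt_one_of_one_lt_of_neg one_lt_two hr)
  have hsum : Summable fun l : ℤ => (2 : ℝ) ^ ((l : ℝ) * s) * min 1 ((2 : ℝ) ^ (-(l : ℝ))) := by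
    refine Summable.of_nat_of_neg ?_ ?_
    · refine Summable.of_nonneg_of_le (fun n => by positivity) (fun n => ?_)
        (hg (s - 1) (by linarith [hs.2]))
      refine (mul_le_mul_of_nonneg_left (min_le_right _ _) (by positivity)).trans (le_of_eq ?_)
      rw [← Real.rpow_add two_pos]
      congr 1
      push_cast
      ring
    · refine Summable.of_nonneg_of_le (fun n => by positivity) (fun n => ?_)
        (hg (-s) (by linarith [hs.1]))
      refine (mul_le_mul_of_nonneg_left (min_le_left _ _) (by positivity)).trans (le_of_eq ?_)
      rw [mul_one]
      congr 1
      push_cast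
      ring
  have e : ∀ l : ℤ, twoPow (l * s) * min 1 (twoPow (-l)) =
      ENNReal.ofReal ((2 : ℝ) ^ ((l : ℝ) * s) * min 1 ((2 : ℝ) ^ (-(l : ℝ)))) := fun l => by
    rw [ENNReal.ofReal_mul (by positivity), ENNReal.ofReal_min, ENNReal.ofReal_one]
    rfl
  simp_rw [e]
  exact hsum.tsum_ofReal_ne_top

end TwoPow

/-! ### The singular weight -/

section Weight

variable {E : Type*} [NormedAddCommGroup E] [InnerProductSpace ℝ E] [FiniteDimensional ℝ E]
  [MeasurableSpace E] [BorelSpace E]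

/-- In polar coordinates the radial density is `r^{1-α}` on `(0, 1]`, integrable as `α < 2`, and
`r^{-α}` on `(1, ∞)`, integrable as `α > 1`. -/
theorem integrable_singular_weight [Nontrivial E] {α : ℝ} (hα : α ∈ Set.Ioo (1 : ℝ) 2) :
    Integrable fun y : E =>
      (‖y‖ ^ ((Module.finrank ℝ E : ℝ) + α))⁻¹ * (‖y‖ * min 1 ‖y‖) := by
  obtain ⟨n, hn⟩ : ∃ n, n = Module.finrank ℝ E := ⟨_, rfl⟩
  rw [← hn]
  have hn1 : 1 ≤ n := hn ▸ Module.finrank_pos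
  rw [integrable_fun_norm_addHaar (volume : Measure E)
    (f := fun r => (r ^ ((n : ℝ) + α))⁻¹ * (r * min 1 r)), ← Set.Ioc_union_Ioi_eq_Ioi zero_le_one,
    integrableOn_union, ← hn]
  have e : ∀ r : ℝ, 0 < r → r ^ (n - 1) * (r ^ ((n : ℝ) + α))⁻¹ * r = r ^ (-α) := fun r hr => by
    rw [Real.rpow_add hr, Real.rpow_neg hr.le, Real.rpow_natCast]
    obtain ⟨m, rfl⟩ := Nat.exists_eq_add_of_le' hn1
    have : r ^ α ≠ 0 := (Real.rpow_pos_of_pos hr α).ne'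
    have : r ≠ 0 := hr.ne'
    simp only [Nat.add_sub_cancel, pow_succ]
    field_simp
  constructor
  · have h1 : IntegrableOn (fun r : ℝ => r ^ (1 - α)) (Set.Ioc 0 1) :=
      (intervalIntegrable_iff_integrableOn_Ioc_of_le zero_le_one).1
        (intervalIntegral.intervalIntegrable_rpow' (by linarith [hα.2]))
    refine h1.congr_fun (fun r hr => ?_) measurableSet_Ioc
    have hr0 : 0 < r := hr.1
    simp only [smul_eq_mul, min_eq_right hr.2]
    rw [← mul_assoc, ← mul_assoc, e r hr0, sub_eq_add_neg, add_comm,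
      Real.rpow_add hr0, Real.rpow_one]
  · have h1 : IntegrableOn (fun r : ℝ => r ^ (-α)) (Set.Ioi 1) :=
      integrableOn_Ioi_rpow_of_lt (by linarith [hα.1]) one_pos
    refine h1.congr_fun (fun r hr => ?_) measurableSet_Ioi
    have hr1 : 1 < r := hr
    simp only [smul_eq_mul, min_eq_left hr1.le]
    rw [← mul_assoc, ← mul_assoc, e r (by linarith), mul_one]

/-- The weight `|y|^{1-n-α} min (1, 2^m |y|)`, where `n` is the dimension. -/
noncomputable def singularWeight (α : ℝ) (m : ℤ) (y : E) : ℝ≥0∞ :=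
  ENNReal.ofReal ((‖y‖ ^ ((Module.finrank ℝ E : ℝ) + α))⁻¹) *
    (‖y‖ₑ * min 1 ‖(2 : ℝ) ^ m • y‖ₑ)

theorem measurable_singularWeight (α : ℝ) (m : ℤ) :
    Measurable (singularWeight α m : E → ℝ≥0∞) := by
  unfold singularWeight
  fun_prop

theorem lintegral_singularWeight_zero_ne_top [Nontrivial E] {α : ℝ}
    (hα : α ∈ Set.Ioo (1 : ℝ) 2) : ∫⁻ y : E, singularWeight α 0 y ≠ ⊤ := by
  have := (integrable_singular_weight (E := E) hα).lintegral_lt_top.ne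
  convert! this using 3 with y
  rw [singularWeight, ENNReal.ofReal_mul (by positivity), ENNReal.ofReal_mul (by positivity),
    ENNReal.ofReal_min, ofReal_norm, ENNReal.ofReal_one, zpow_zero, one_smul]

theorem lintegral_singularWeight (α : ℝ) (m : ℤ) :
    ∫⁻ y : E, singularWeight α m y =
      twoPow (m * (α - 1)) * ∫⁻ y : E, singularWeight α 0 y := by
  set n := Module.finrank ℝ E with hn
  have h0 : (2 : ℝ) ^ m ≠ 0 := by positivity
  -- The weight is homogeneous under `y ↦ 2^m y`; the Jacobian `2^{-mn}` then reduces the exponent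
  -- `m(n + α - 1)` to `m(α - 1)`.
  have e : ∀ y : E, singularWeight α m y =
      twoPow (m * (n + α - 1)) * singularWeight α 0 ((2 : ℝ) ^ m • y) := fun y => by
    simp only [singularWeight, zpow_zero, one_smul]
    rw [norm_smul, Real.norm_of_nonneg (by positivity),
      Real.mul_rpow (by positivity) (norm_nonneg _), mul_inv,
      ENNReal.ofReal_mul (by positivity), ← Real.rpow_intCast, ← Real.rpow_mul zero_le_two,
      ← Real.rpow_neg zero_le_two, Real.rpow_intCast, enorm_two_zpow_smul]
    change _ = twoPow (m * (n + α - 1)) * (twoPow (-(m * (n + α))) * _ * _)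
    calc _ = (twoPow (m * (n + α - 1)) * twoPow (-(m * (n + α))) * twoPow m) *
          (ENNReal.ofReal ((‖y‖ ^ ((n : ℝ) + α))⁻¹) * (‖y‖ₑ * min 1 (twoPow m * ‖y‖ₑ))) := by
          rw [← twoPow_add, ← twoPow_add,
            show (m : ℝ) * (n + α - 1) + -(m * (n + α)) + m = 0 by ring, twoPow_zero, one_mul]
      _ = _ := by ring
  simp_rw [e]
  rw [lintegral_const_mul _ (f := fun y : E => singularWeight α 0 ((2 : ℝ) ^ m • y))
      ((measurable_singularWeight α 0).comp (measurable_const_smul _)),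
    ← lintegral_map (measurable_singularWeight α 0) (measurable_const_smul _),
    Measure.map_addHaar_smul _ h0, lintegral_smul_measure, smul_eq_mul, ← mul_assoc]
  congr 1
  have : ENNReal.ofReal |(((2 : ℝ) ^ m) ^ n)⁻¹| = twoPow (-(m * n)) := by
    rw [abs_of_pos (by positivity), twoPow, Real.rpow_neg zero_le_two, Real.rpow_mul zero_le_two,
      Real.rpow_intCast, Real.rpow_natCast]
  rw [← hn, this, ← twoPow_add]
  congr 1; ring

end Weight

/-! ### The nonlocal bilinear term -/

section Nonlocal

variable {d : ℕ} {F : Type*} [NormedAddCommGroup F] [NormedSpace ℂ F]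

/-- Dominated convergence. The origin is removed by every truncation, so `f 0 = 0` makes the
convergence pointwise everywhere, with no appeal to the origin being null. -/
theorem HasPrincipalValue.of_integrable {f : EuclideanSpace ℝ (Fin d) → F} (hf : Integrable f)
    (hf0 : f 0 = 0) :
    HasPrincipalValue f (∫ y, f y) := by
  refine ⟨fun ε _ => hf.integrableOn, ?_⟩
  have hms : ∀ ε : ℝ, MeasurableSet {y : EuclideanSpace ℝ (Fin d) | ε < ‖y‖} := fun ε =>
    (isOpen_lt continuous_const continuous_norm).measurableSet
  simp_rw [← integral_indicator (hms _)]
  refine tendsto_integral_filter_of_dominated_convergence (fun y => ‖f y‖)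
    (Eventually.of_forall fun ε => hf.aestronglyMeasurable.indicator (hms ε))
    (Eventually.of_forall fun ε => Eventually.of_forall fun y => norm_indicator_le_norm_self _ _)
    hf.norm (Eventually.of_forall fun y => ?_)
  rcases eq_or_ne y 0 with rfl | hy
  · refine tendsto_const_nhds.congr fun ε => ?_
    simp [Set.indicator, hf0]
  · refine tendsto_const_nhds.congr' ?_
    filter_upwards [Ioo_mem_nhdsGT (norm_pos_iff.2 hy)] with ε hε
    rw [Set.indicator_of_mem]
    exact hε.2

/-- The nonlocal term as an absolutely convergent integral. -/
noncomputable def nonlocalIntegral (α : ℝ) (u : EuclideanSpace ℝ (Fin d) → F)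
    (σ : EuclideanSpace ℝ (Fin d) → ℂ) (x : EuclideanSpace ℝ (Fin d)) : F :=
  ∫ y, nonlocalIntegrand α u σ x y

theorem nonlocalIntegrand_zero (α : ℝ) (u : EuclideanSpace ℝ (Fin d) → F) (σ : EuclideanSpace ℝ
    (Fin d) → ℂ) (x : EuclideanSpace ℝ (Fin d)) :
    nonlocalIntegrand α u σ x 0 = 0 := by
  simp [nonlocalIntegrand]

theorem stronglyMeasurable_nonlocalIntegrand (α : ℝ) {u : EuclideanSpace ℝ (Fin d) → F}
    {σ : EuclideanSpace ℝ (Fin d) → ℂ}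
    (hu : Continuous u) (hσ : Continuous σ) :
    StronglyMeasurable (Function.uncurry (nonlocalIntegrand α u σ)) := by
  have h1 : Measurable fun q : EuclideanSpace ℝ (Fin d) × EuclideanSpace ℝ (Fin d) => (‖q.2‖ ^
      ((d : ℝ) + α))⁻¹ := by fun_prop
  have h2 : Continuous fun q : EuclideanSpace ℝ (Fin d) × EuclideanSpace ℝ (Fin d) =>
      (σ (q.1 + q.2) - σ q.1) • (u (q.1 + q.2) - u q.1) := by fun_prop
  exact h1.stronglyMeasurable.smul h2.stronglyMeasurable

theorem stronglyMeasurable_nonlocalIntegral (α : ℝ) {u : EuclideanSpace ℝ (Fin d) → F}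
    {σ : EuclideanSpace ℝ (Fin d) → ℂ}
    (hu : Continuous u) (hσ : Continuous σ) : StronglyMeasurable (nonlocalIntegral α u σ) :=
  (stronglyMeasurable_nonlocalIntegrand α hu hσ).integral_prod_right

theorem norm_nonlocalIntegrand_le (α : ℝ) {u : EuclideanSpace ℝ (Fin d) → F} {σ : EuclideanSpace ℝ
    (Fin d) → ℂ} {x : EuclideanSpace ℝ (Fin d)} {A B : ℝ}
    (hu : ∀ y, ‖u (x + y) - u x‖ ≤ A * ‖y‖) (hσ : ∀ y, ‖σ (x + y) - σ x‖ ≤ B * min 1 ‖y‖)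
        (y : EuclideanSpace ℝ (Fin d)) :
    ‖nonlocalIntegrand α u σ x y‖ ≤
      B * A * ((‖y‖ ^ ((d : ℝ) + α))⁻¹ * (‖y‖ * min 1 ‖y‖)) := by
  have h0 : 0 ≤ (‖y‖ ^ ((d : ℝ) + α))⁻¹ := by positivity
  rw [nonlocalIntegrand, norm_smul, norm_smul, Real.norm_of_nonneg h0]
  calc _ ≤ (‖y‖ ^ ((d : ℝ) + α))⁻¹ * ((B * min 1 ‖y‖) * (A * ‖y‖)) := by
        refine mul_le_mul_of_nonneg_left ?_ h0
        exact mul_le_mul (hσ y) (hu y) (norm_nonneg _) ((norm_nonneg _).trans (hσ y))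
    _ = _ := by ring

theorem integrable_norm_weight (hd : 1 ≤ d) {α : ℝ} (hα : α ∈ Set.Ioo (1 : ℝ) 2) :
    Integrable fun y : EuclideanSpace ℝ (Fin d) => (‖y‖ ^ ((d : ℝ) + α))⁻¹ * (‖y‖ * min 1 ‖y‖) := by
  have : Nonempty (Fin d) := ⟨⟨0, hd⟩⟩
  simpa only [finrank_euclideanSpace_fin] using integrable_singular_weight (E := EuclideanSpace ℝ
      (Fin d)) hα

theorem IsBoundedC1.norm_sub_le_min {E G : Type*} [NormedAddCommGroup E]
    [InnerProductSpace ℝ E] [NormedAddCommGroup G] [NormedSpace ℝ G] [FiniteDimensional ℝ E]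
    [MeasurableSpace E] [BorelSpace E] {w : E → G} {W : E → E →L[ℝ] G} (h : IsBoundedC1 w W)
    {C D : ℝ} (hC : ∀ x, ‖w x‖ ≤ C) (hD : ∀ x, ‖W x‖ ≤ D) (x y : E) :
    ‖w (x + y) - w x‖ ≤ max (C + C) D * min 1 ‖y‖ := by
  rcases le_total 1 ‖y‖ with hy | hy
  · rw [min_eq_left hy, mul_one]
    exact (norm_finDiff_le hC y x).trans (le_max_left _ _)
  · rw [min_eq_right hy]
    exact (h.norm_sub_le_of_bound hD x y).trans
      (mul_le_mul_of_nonneg_right (le_max_right _ _) (norm_nonneg _))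

variable {u : EuclideanSpace ℝ (Fin d) → F} {U : EuclideanSpace ℝ (Fin d) → EuclideanSpace ℝ
    (Fin d) →L[ℝ] F} {σ : EuclideanSpace ℝ (Fin d) → ℂ} {S : EuclideanSpace ℝ (Fin d) →
    EuclideanSpace ℝ (Fin d) →L[ℝ] ℂ}

theorem exists_norm_nonlocalIntegrand_le (α : ℝ) (hu : IsBoundedC1 u U) (hσ : IsBoundedC1 σ S) :
    ∃ D, ∀ x y, ‖nonlocalIntegrand α u σ x y‖ ≤
      D * ((‖y‖ ^ ((d : ℝ) + α))⁻¹ * (‖y‖ * min 1 ‖y‖)) := by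
  obtain ⟨A, hA⟩ := hu.bdd_deriv
  obtain ⟨B, hB⟩ := hσ.bdd
  obtain ⟨B', hB'⟩ := hσ.bdd_deriv
  exact ⟨max (B + B) B' * A, fun x y => norm_nonlocalIntegrand_le α
    (hu.norm_sub_le_of_bound hA x) (hσ.norm_sub_le_min hB hB' x) y⟩

theorem integrable_nonlocalIntegrand (hd : 1 ≤ d) {α : ℝ} (hα : α ∈ Set.Ioo (1 : ℝ) 2)
    (hu : IsBoundedC1 u U) (hσ : IsBoundedC1 σ S) (x : EuclideanSpace ℝ (Fin d)) :
    Integrable (nonlocalIntegrand α u σ x) := by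
  obtain ⟨D, hD⟩ := exists_norm_nonlocalIntegrand_le α hu hσ
  exact ((integrable_norm_weight hd hα).const_mul D).mono'
    ((stronglyMeasurable_nonlocalIntegrand α hu.continuous hσ.continuous).comp_measurable
      measurable_prodMk_left).aestronglyMeasurable (Eventually.of_forall (hD x))

theorem exists_norm_nonlocalIntegral_le (hd : 1 ≤ d) {α : ℝ} (hα : α ∈ Set.Ioo (1 : ℝ) 2)
    (hu : IsBoundedC1 u U) (hσ : IsBoundedC1 σ S) :
    ∃ D, ∀ x, ‖nonlocalIntegral α u σ x‖ ≤ D := by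
  obtain ⟨D, hD⟩ := exists_norm_nonlocalIntegrand_le α hu hσ
  exact ⟨_, fun x => norm_integral_le_of_norm_le ((integrable_norm_weight hd hα).const_mul D)
    (Eventually.of_forall (hD x))⟩

theorem hasPrincipalValue_nonlocalIntegral (hd : 1 ≤ d) {α : ℝ} (hα : α ∈ Set.Ioo (1 : ℝ) 2)
    (hu : IsBoundedC1 u U) (hσ : IsBoundedC1 σ S) (x : EuclideanSpace ℝ (Fin d)) :
    HasPrincipalValue (nonlocalIntegrand α u σ x) (nonlocalIntegral α u σ x) :=
  .of_integrable (integrable_nonlocalIntegrand hd hα hu hσ x) (nonlocalIntegrand_zero α u σ x)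

theorem nonlocalTerm_eq_nonlocalIntegral (hd : 1 ≤ d) {α : ℝ} (hα : α ∈ Set.Ioo (1 : ℝ) 2)
    (hu : IsBoundedC1 u U) (hσ : IsBoundedC1 σ S) :
    nonlocalTerm α u σ = nonlocalIntegral α u σ :=
  funext fun x => (hasPrincipalValue_nonlocalIntegral hd hα hu hσ x).2.limUnder_eq

/-- Discrete Leibniz rule: the form is bilinear and commutes with translations, so a difference
falls on one argument at a time, with the other possibly translated. -/
theorem finDiff_nonlocalIntegral (hd : 1 ≤ d) {α : ℝ} (hα : α ∈ Set.Ioo (1 : ℝ) 2)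
    (hu : IsBoundedC1 u U) (hσ : IsBoundedC1 σ S) (z x : EuclideanSpace ℝ (Fin d)) :
    finDiff z (nonlocalIntegral α u σ) x =
      nonlocalIntegral α (finDiff z u) (fun x => σ (x + z)) x +
        nonlocalIntegral α u (finDiff z σ) x := by
  unfold nonlocalIntegral
  rw [← integral_add (integrable_nonlocalIntegrand hd hα (hu.finDiff z) (hσ.comp_add_right z) x)
    (integrable_nonlocalIntegrand hd hα hu (hσ.finDiff z) x), finDiff,
    ← integral_sub (integrable_nonlocalIntegrand hd hα hu hσ _)
      (integrable_nonlocalIntegrand hd hα hu hσ _)]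
  congr 1; funext y
  simp only [nonlocalIntegrand, finDiff]
  rw [← smul_sub, ← smul_add, add_right_comm x z y]
  congr 1
  module

variable [CompleteSpace F]

/-- Minkowski in `y`, then Hölder for each fixed `y`. The mean value bound on `u` supplies `|y|` and
the bound on `σ` supplies `min(1, 2^m |y|)`, which together build the singular weight. -/
theorem eLpNorm_nonlocalIntegral_le (α : ℝ) (hu : IsBoundedC1 u U) (hσ : Continuous σ)
    {p q r : ℝ≥0∞} [ENNReal.HolderTriple q p r] (hp : 1 ≤ p) (hr : 1 ≤ r) (m : ℤ) {B : ℝ≥0∞}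
    (hB : ∀ y, eLpNorm (finDiff y σ) q volume ≤ B * min 1 ‖(2 : ℝ) ^ m • y‖ₑ) :
    eLpNorm (nonlocalIntegral α u σ) r volume ≤
      twoPow (m * (α - 1)) * (∫⁻ y : EuclideanSpace ℝ (Fin d), singularWeight α 0 y) *
          (B * eLpNorm U p volume) := by
  rw [← lintegral_singularWeight, ← lintegral_mul_const _ (measurable_singularWeight α m)]
  refine eLpNorm_integral_le hr
    (stronglyMeasurable_nonlocalIntegrand α hu.continuous hσ)
    ((measurable_singularWeight α m).mul_const _) fun y => ?_
  have e : (fun x => nonlocalIntegrand α u σ x y) =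
      (‖y‖ ^ ((d : ℝ) + α))⁻¹ • (finDiff y σ • finDiff y u) := rfl
  rw [e, eLpNorm_const_smul, Real.enorm_eq_ofReal (by positivity)]
  calc _ ≤ ENNReal.ofReal ((‖y‖ ^ ((d : ℝ) + α))⁻¹) *
        ((B * min 1 ‖(2 : ℝ) ^ m • y‖ₑ) * (‖y‖ₑ * eLpNorm U p volume)) := by
        gcongr
        refine (eLpNorm_smul_le_mul_eLpNorm (hu.continuous.finDiff y).aestronglyMeasurable
          (hσ.finDiff y).aestronglyMeasurable (p := q) (q := p)).trans ?_
        gcongr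
        · exact hB y
        · exact hu.eLpNorm_finDiff_le hp y
    _ = _ := by
        rw [singularWeight, finrank_euclideanSpace_fin]
        ring

theorem eLpNorm_finDiff_nonlocalIntegral_le (hd : 1 ≤ d) {α : ℝ} (hα : α ∈ Set.Ioo (1 : ℝ) 2)
    (hu : IsBoundedC1 u U) (hσ : IsBoundedC1 σ S)
    {p q r : ℝ≥0∞} [ENNReal.HolderTriple q p r] (hp : 1 ≤ p) (hr : 1 ≤ r) (m : ℤ) {B B' : ℝ≥0∞}
    (hB : ∀ y, eLpNorm (finDiff y σ) q volume ≤ B * min 1 ‖(2 : ℝ) ^ m • y‖ₑ)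
        (z : EuclideanSpace ℝ (Fin d))
    (hB' : ∀ y, eLpNorm (finDiff y (finDiff z σ)) q volume ≤ B' * min 1 ‖(2 : ℝ) ^ m • y‖ₑ) :
    eLpNorm (finDiff z (nonlocalIntegral α u σ)) r volume ≤
      twoPow (m * (α - 1)) * (∫⁻ y : EuclideanSpace ℝ (Fin d), singularWeight α 0 y) *
        (B * eLpNorm (finDiff z U) p volume + B' * eLpNorm U p volume) := by
  have hz := hσ.comp_add_right z
  have hB'' : ∀ y, eLpNorm (finDiff y fun x => σ (x + z)) q volume ≤
      B * min 1 ‖(2 : ℝ) ^ m • y‖ₑ := fun y => by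
    have : (finDiff y fun x => σ (x + z)) = fun x => finDiff y σ (x + z) := by
      funext x
      simp only [finDiff, add_right_comm]
    rw [this, eLpNorm_comp_add_right (hσ.continuous.finDiff y)]
    exact hB y
  rw [show finDiff z (nonlocalIntegral α u σ) = _ from
    funext (finDiff_nonlocalIntegral hd hα hu hσ z), mul_add]
  refine (eLpNorm_add_le (stronglyMeasurable_nonlocalIntegral α (hu.finDiff z).continuous
    hz.continuous).aestronglyMeasurable (stronglyMeasurable_nonlocalIntegral α hu.continuous
    (hσ.finDiff z).continuous).aestronglyMeasurable hr).trans (add_le_add ?_ ?_)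
  · exact eLpNorm_nonlocalIntegral_le α (hu.finDiff z) hz.continuous hp hr m hB''
  · exact eLpNorm_nonlocalIntegral_le α hu (hσ.finDiff z).continuous hp hr m hB'

end Nonlocal

/-! ### Besov norms by interpolation -/

section Interpolation

variable {E G : Type*} [NormedAddCommGroup E] [InnerProductSpace ℝ E] [FiniteDimensional ℝ E]
  [MeasurableSpace E] [BorelSpace E] [NormedAddCommGroup G] [NormedSpace ℂ G] [CompleteSpace G]

/-- Since `h` has mean zero, `f x` may be subtracted inside the integral, leaving a difference of
`f` with step of length `2^{-l} |y|`. -/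
theorem eLpNorm_scaledConv_le_of_finDiff {h : 𝓢(E, ℂ)} (h0 : ∫ y, h y = 0) (l : ℤ) {f : E → G}
    (hf : StronglyMeasurable f) (hfb : ∃ C, ∀ x, ‖f x‖ ≤ C) {p : ℝ≥0∞} (hp : 1 ≤ p) {D : ℝ≥0∞}
    (hD : ∀ z, eLpNorm (finDiff z f) p volume ≤ D * ‖z‖ₑ) :
    eLpNorm (scaledConv h l f) p volume ≤ (∫⁻ y, ‖h y‖ₑ * ‖y‖ₑ) * (twoPow (-l) * D) := by
  obtain ⟨C, hC⟩ := hfb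
  have e : scaledConv h l f =
      fun x => ∫ y, h y • finDiff (-((2 : ℝ) ^ (-l) • y)) f x := by
    funext x
    simp only [finDiff, ← sub_eq_add_neg, smul_sub]
    have hm : StronglyMeasurable fun y => f (x - (2 : ℝ) ^ (-l) • y) :=
      hf.comp_measurable (by fun_prop)
    have hi : Integrable fun y => h y • f (x - (2 : ℝ) ^ (-l) • y) :=
      h.integrable.smul_bdd C hm.aestronglyMeasurable (Eventually.of_forall fun y => hC _)
    rw [integral_sub hi (h.integrable.smul_const (f x)), integral_smul_const, h0, zero_smul,
        sub_zero]
    rfl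
  have hm : Continuous fun y => ‖h y‖ₑ * ‖y‖ₑ := by
    have := h.continuous
    simp_rw [← enorm_norm (h _), ← enorm_norm (_ : E), ← enorm_mul]
    fun_prop
  rw [e, ← lintegral_mul_const _ hm.measurable]
  have hm2 : StronglyMeasurable (Function.uncurry fun x y =>
      h y • finDiff (-((2 : ℝ) ^ (-l) • y)) f x) :=
    (h.continuous.comp continuous_snd).stronglyMeasurable.smul
      ((hf.comp_measurable (by fun_prop : Measurable fun q : E × E =>
        q.1 + -((2 : ℝ) ^ (-l) • q.2))).sub (hf.comp_measurable measurable_fst))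
  refine eLpNorm_integral_le hp hm2 (hm.measurable.mul_const _) fun y => ?_
  have e2 : (fun x => h y • finDiff (-((2 : ℝ) ^ (-l) • y)) f x) =
    h y • finDiff (-((2 : ℝ) ^ (-l) • y)) f := rfl
  rw [e2, eLpNorm_const_smul, mul_assoc]
  gcongr
  refine (hD _).trans (le_of_eq ?_)
  rw [enorm_neg, enorm_two_zpow_smul, Int.cast_neg]
  ring

/-- A function whose `L^p` norm is at most `A` and whose first order differences are those of a
function of frequency at most `2^m` has Besov norm at most a multiple of `2^{ms} A`. -/
theorem tsum_eLpNorm_scaledConv_le {h : 𝓢(E, ℂ)} (h0 : ∫ y, h y = 0) {f : E → G}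
    (hf : StronglyMeasurable f) (hfb : ∃ C, ∀ x, ‖f x‖ ≤ C) {p : ℝ≥0∞} (hp : 1 ≤ p) {A : ℝ≥0∞}
    (hA : eLpNorm f p volume ≤ A) (m : ℤ)
    (hD : ∀ z, eLpNorm (finDiff z f) p volume ≤ twoPow m * A * ‖z‖ₑ) (s : ℝ) :
    ∑' l : ℤ, twoPow (l * s) * eLpNorm (scaledConv h l f) p volume ≤
      ((∫⁻ y, ‖h y‖ₑ) + ∫⁻ y, ‖h y‖ₑ * ‖y‖ₑ) *
        (∑' l : ℤ, twoPow (l * s) * min 1 (twoPow (-l))) * (twoPow (m * s) * A) := by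
  set H := (∫⁻ y, ‖h y‖ₑ) + ∫⁻ y, ‖h y‖ₑ * ‖y‖ₑ with hH
  -- Young's inequality is used for `l` below `m`, the mean zero of `h` for `l` above: each extra
  -- octave gains a factor `1/2`.
  have hb : ∀ l : ℤ, eLpNorm (scaledConv h l f) p volume ≤
      H * (min 1 (twoPow (-((l - m : ℤ) : ℝ))) * A) := fun l => by
    rcases min_choice 1 (twoPow (-((l - m : ℤ) : ℝ))) with hl | hl
    · rw [hl, one_mul]
      refine (eLpNorm_scaledConv_le h.continuous l hf hp).trans ?_
      gcongr
      exact le_self_add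
    · rw [hl]
      refine (eLpNorm_scaledConv_le_of_finDiff h0 l hf hfb hp hD).trans ?_
      rw [← mul_assoc (twoPow _), ← twoPow_add]
      gcongr
      · exact le_add_self
      · refine le_of_eq ?_
        congr 1
        push_cast
        ring
  calc _ ≤ ∑' l : ℤ, twoPow (l * s) * (H * (min 1 (twoPow (-((l - m : ℤ) : ℝ))) * A)) := by
        gcongr with l
        exact hb l
    -- Re-centring the sum at `l = m` extracts `2^{ms}` and leaves a series independent of `m`.
    _ = ∑' l : ℤ, twoPow ((l - m : ℤ) * s) * min 1 (twoPow (-((l - m : ℤ) : ℝ))) *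
          (H * (twoPow (m * s) * A)) := by
        congr 1; funext l
        have : twoPow (l * s) = twoPow ((l - m : ℤ) * s) * twoPow (m * s) := by
          rw [← twoPow_add]
          congr 1
          push_cast
          ring
        rw [this]
        ring
    _ = _ := by
        have := (Equiv.subRight m).tsum_eq
          (fun l : ℤ => twoPow (l * s) * min 1 (twoPow (-(l : ℝ))))
        simp only [Equiv.subRight_apply] at this
        rw [ENNReal.tsum_mul_right, this]
        ring

end Interpolation

/-! ### Littlewood-Paley cut-offs -/

section Cutoff

theorem sum_Ico_neg_sub {G : Type*} [AddCommGroup G] (b : ℤ → G) (n : ℕ) :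
    ∑ j ∈ Finset.Ico (-(n : ℤ)) n, (b (j + 1) - b j) = b n - b (-n) := by
  induction n with
  | zero => simp
  | succ n ih =>
    have e : Finset.Ico (-((n + 1 : ℕ) : ℤ)) ((n + 1 : ℕ) : ℤ) =
        insert (-((n : ℤ) + 1)) (insert (n : ℤ) (Finset.Ico (-(n : ℤ)) n)) := by
      ext j
      simp only [Finset.mem_Ico, Finset.mem_insert]
      omega
    rw [e, Finset.sum_insert, Finset.sum_insert, ih]
    · rw [show -((n : ℤ) + 1) + 1 = -n by ring]
      push_cast
      abel_nf
    · simp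
    · simp only [Finset.mem_Ico, Finset.mem_insert]
      omega

theorem tendsto_Ico_neg_atTop :
    Tendsto (fun n : ℕ => Finset.Ico (-(n : ℤ)) n) atTop atTop := by
  refine tendsto_atTop_finset_of_monotone (fun m n h j hj => ?_) fun j => ⟨j.natAbs + 1, ?_⟩
  · simp only [Finset.mem_Ico] at hj ⊢
    omega
  · simp only [Finset.mem_Ico]
    omega

variable {d : ℕ} {χ : EuclideanSpace ℝ (Fin d) → ℝ}

namespace IsLittlewoodPaleyCutoff

theorem eq_zero_of_le (hχ : IsLittlewoodPaleyCutoff χ) {ξ : EuclideanSpace ℝ (Fin d)}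
    (hξ : 4 / 3 ≤ ‖ξ‖) : χ ξ = 0 := by
  refine image_eq_zero_of_notMem_tsupport fun h => ?_
  have := hχ.tsupport_subset h
  rw [mem_ball_zero_iff] at this
  linarith

theorem lpAnnulus_eq_zero (hχ : IsLittlewoodPaleyCutoff χ) {ξ : EuclideanSpace ℝ (Fin d)}
    (hξ : ‖ξ‖ < 3 / 4 ∨ 8 / 3 ≤ ‖ξ‖) : lpAnnulus χ ξ = 0 := by
  refine image_eq_zero_of_notMem_tsupport fun h => ?_
  have := hχ.tsupport_annulus_subset h
  rw [Set.mem_sdiff, mem_ball_zero_iff, mem_ball_zero_iff] at this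
  rcases hξ with h | h
  · exact this.2 h
  · linarith [this.1]

/-- At some `ξ ≠ 0` the symmetric partial sums of the partition of unity telescope to `χ(2^{-n} ξ) -
χ(2^n ξ)`. These tend to 1 by assumption, and to `χ 0` by continuity and compact support. -/
theorem apply_zero (hχ : IsLittlewoodPaleyCutoff χ) (hd : 1 ≤ d) : χ 0 = 1 := by
  have : Nonempty (Fin d) := ⟨⟨0, hd⟩⟩
  obtain ⟨ξ, hξ⟩ := exists_ne (0 : EuclideanSpace ℝ (Fin d))
  have h1 := (hχ.hasSum_one ξ hξ).comp tendsto_Ico_neg_atTop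
  have e : ∀ n : ℕ, ∑ j ∈ Finset.Ico (-(n : ℤ)) n, lpAnnulus χ ((2 : ℝ) ^ (-j) • ξ) =
      χ ((2 : ℝ) ^ (-(n : ℤ)) • ξ) - χ ((2 : ℝ) ^ (n : ℤ) • ξ) := fun n => by
    have := sum_Ico_neg_sub (fun j : ℤ => χ ((2 : ℝ) ^ (-j) • ξ)) n
    rw [neg_neg] at this
    rw [← this]
    refine Finset.sum_congr rfl fun j _ => ?_
    rw [lpAnnulus, smul_smul]
    congr 3
    rw [neg_add, zpow_add₀ two_ne_zero, zpow_neg_one, mul_comm]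
  have h2 : Tendsto (fun n : ℕ => χ ((2 : ℝ) ^ (-(n : ℤ)) • ξ) - χ ((2 : ℝ) ^ (n : ℤ) • ξ))
      atTop (𝓝 (χ 0 - 0)) := by
    refine Tendsto.sub ?_ ?_
    · have h3 : Tendsto (fun n : ℕ => (2 : ℝ) ^ (-(n : ℤ)) • ξ) atTop (𝓝 0) := by
        have := (tendsto_two_zpow_atBot.comp
          (tendsto_neg_atTop_atBot.comp tendsto_natCast_atTop_atTop)).smul_const ξ
        simpa using this
      exact (hχ.smooth.continuous.tendsto 0).comp h3
    · have h3 : Tendsto (fun n : ℕ => (2 : ℝ) ^ (n : ℤ) * ‖ξ‖) atTop atTop :=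
        (tendsto_two_zpow_atTop.comp tendsto_natCast_atTop_atTop).atTop_mul_const
          (norm_pos_iff.2 hξ)
      refine tendsto_const_nhds.congr' ?_
      filter_upwards [h3.eventually_ge_atTop (4 / 3)] with n hn
      rw [hχ.eq_zero_of_le]
      rwa [norm_smul, Real.norm_of_nonneg (by positivity)]
  have h4 := tendsto_nhds_unique h2 (h1.congr fun n => e n)
  simpa using h4

/-- As `φ` vanishes on this ball, halving the argument does not change `χ`; iterating leads to the
value at 0. -/
theorem eq_one_of_lt (hχ : IsLittlewoodPaleyCutoff χ) (hd : 1 ≤ d)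
    {ξ : EuclideanSpace ℝ (Fin d)} (hξ : ‖ξ‖ < 3 / 4) : χ ξ = 1 := by
  have h2 : ∀ n : ℕ, χ (((2 : ℝ)⁻¹) ^ n • ξ) = χ ξ := fun n => by
    induction n with
    | zero => simp
    | succ n ih =>
      rw [← ih, pow_succ', mul_smul]
      refine sub_eq_zero.1 (hχ.lpAnnulus_eq_zero (Or.inl ?_))
      rw [norm_smul, Real.norm_of_nonneg (by positivity)]
      refine lt_of_le_of_lt (mul_le_of_le_one_left (norm_nonneg _) ?_) hξ
      exact pow_le_one₀ (by norm_num) (by norm_num)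
  have h3 : Tendsto (fun n : ℕ => ((2 : ℝ)⁻¹) ^ n • ξ) atTop (𝓝 0) := by
    simpa using (tendsto_pow_atTop_nhds_zero_of_lt_one (r := (2 : ℝ)⁻¹) (by norm_num)
      (by norm_num)).smul_const ξ
  have h4 := ((hχ.smooth.continuous.tendsto 0).comp h3).congr h2
  rw [hχ.apply_zero hd] at h4
  exact tendsto_nhds_unique tendsto_const_nhds h4

/-- A cut-off as a complex-valued Schwartz function. -/
noncomputable def toSchwartz (hχ : IsLittlewoodPaleyCutoff χ) : 𝓢(EuclideanSpace ℝ (Fin d), ℂ) :=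
  HasCompactSupport.toSchwartzMap (f := fun ξ => (χ ξ : ℂ))
    ((HasCompactSupport.of_support_subset_isCompact (isCompact_closedBall 0 (4 / 3))
      ((subset_tsupport χ).trans (hχ.tsupport_subset.trans
          Metric.ball_subset_closedBall))).comp_left
        Complex.ofReal_zero)
    (Complex.ofRealCLM.contDiff.comp hχ.smooth)

theorem toSchwartz_apply (hχ : IsLittlewoodPaleyCutoff χ) (ξ : EuclideanSpace ℝ (Fin d)) :
    hχ.toSchwartz ξ = (χ ξ : ℂ) := rfl

/-- The rescaled cut-off `ξ ↦ χ (ξ / r)` as a complex-valued Schwartz function. -/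
noncomputable def dilate (hχ : IsLittlewoodPaleyCutoff χ) (r : ℝˣ) :
    𝓢(EuclideanSpace ℝ (Fin d), ℂ) :=
  SchwartzMap.compCLMOfContinuousLinearEquiv ℂ (ContinuousLinearEquiv.smulLeft r⁻¹) hχ.toSchwartz

theorem dilate_apply (hχ : IsLittlewoodPaleyCutoff χ) (r : ℝˣ) (ξ : EuclideanSpace ℝ (Fin d)) :
    hχ.dilate r ξ = (χ ((r : ℝ)⁻¹ • ξ) : ℂ) := by
  rw [← Units.val_inv_eq_inv_val]
  rfl

/-- The Littlewood-Paley kernel as a Schwartz function. -/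
noncomputable def kernel (hχ : IsLittlewoodPaleyCutoff χ) : 𝓢(EuclideanSpace ℝ (Fin d), ℂ) :=
  fourierKernel (hχ.dilate (Units.mk0 2 two_ne_zero) - hχ.toSchwartz)

theorem annulus_apply (hχ : IsLittlewoodPaleyCutoff χ) (ξ : EuclideanSpace ℝ (Fin d)) :
    (hχ.dilate (Units.mk0 2 two_ne_zero) - hχ.toSchwartz) ξ = (lpAnnulus χ ξ : ℂ) := by
  rw [_root_.sub_apply, dilate_apply, toSchwartz_apply, lpAnnulus, Complex.ofReal_sub,
    Units.val_mk0]

theorem coe_kernel (hχ : IsLittlewoodPaleyCutoff χ) : ⇑hχ.kernel = lpKernel χ := by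
  funext x
  rw [kernel, fourierKernel_apply, lpKernel, finrank_euclideanSpace_fin]
  rw [show ⇑(hχ.dilate (Units.mk0 2 two_ne_zero) - hχ.toSchwartz) = fun ξ => (lpAnnulus χ ξ : ℂ)
    from funext hχ.annulus_apply]

theorem integral_kernel (hχ : IsLittlewoodPaleyCutoff χ) : ∫ x, hχ.kernel x = 0 := by
  rw [kernel, integral_fourierKernel, annulus_apply, hχ.lpAnnulus_eq_zero (by left; simp),
    Complex.ofReal_zero]

/-- The kernel of the low frequency cut-off. -/
noncomputable def lowKernel (hχ : IsLittlewoodPaleyCutoff χ) : 𝓢(EuclideanSpace ℝ (Fin d), ℂ) :=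
  fourierKernel hχ.toSchwartz

theorem integral_lowKernel (hχ : IsLittlewoodPaleyCutoff χ) (hd : 1 ≤ d) :
    ∫ x, hχ.lowKernel x = 1 := by
  rw [lowKernel, integral_fourierKernel, toSchwartz_apply, hχ.apply_zero hd, Complex.ofReal_one]

theorem kernel_eq_sub (hχ : IsLittlewoodPaleyCutoff χ) (x : EuclideanSpace ℝ (Fin d)) :
    hχ.kernel x = ((2 : ℝ) ^ d) • hχ.lowKernel ((2 : ℝ) • x) - hχ.lowKernel x := by
  rw [kernel, fourierKernel_sub, _root_.sub_apply, lowKernel,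
    fourierKernel_of_comp_smul two_pos (ψ := hχ.toSchwartz) (fun ξ => ?_),
    finrank_euclideanSpace_fin]
  rw [dilate_apply, toSchwartz_apply, Units.val_mk0]

/-- A kernel whose Fourier transform is equal to one on the support of `φ`. -/
noncomputable def reproducingKernel (hχ : IsLittlewoodPaleyCutoff χ) :
    𝓢(EuclideanSpace ℝ (Fin d), ℂ) :=
  fourierKernel (hχ.dilate (Units.mk0 4 four_ne_zero))

theorem reproducingKernel_convolution (hχ : IsLittlewoodPaleyCutoff χ) (hd : 1 ≤ d)
    (w : EuclideanSpace ℝ (Fin d)) :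
    ∫ y, hχ.reproducingKernel y * hχ.kernel (w - y) = hχ.kernel w := by
  refine fourierKernel_mul_convolution (fun ξ => ?_) w
  rw [annulus_apply, dilate_apply, Units.val_mk0]
  by_cases h : ‖ξ‖ < 8 / 3
  -- Why the dilation factor is 4: `|ξ| < 8/3` gives `|ξ/4| < 2/3 < 3/4`, where the cut-off equals
  -- one.
  · rw [hχ.eq_one_of_lt hd, Complex.ofReal_one, one_mul]
    rw [norm_smul, Real.norm_of_nonneg (by positivity)]
    linarith
  · rw [hχ.lpAnnulus_eq_zero (Or.inr (not_lt.1 h)), Complex.ofReal_zero, mul_zero]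

variable {G : Type*} [NormedAddCommGroup G] [NormedSpace ℂ G]

theorem dyadicBlock_eq_scaledConv (hχ : IsLittlewoodPaleyCutoff χ) (j : ℤ)
    (f : EuclideanSpace ℝ (Fin d) → G) : dyadicBlock χ j f = scaledConv hχ.kernel j f := by
  funext x
  have h0 : (0 : ℝ) < 2 ^ j := by positivity
  have := Measure.integral_comp_smul_of_nonneg (volume : Measure (EuclideanSpace ℝ (Fin d)))
    (fun y => lpKernel χ y • f (x - (2 : ℝ) ^ (-j) • y)) ((2 : ℝ) ^ j) (hR := h0.le)
  rw [dyadicBlock, scaledConv, coe_kernel]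
  simp only [smul_smul, zpow_neg, inv_mul_cancel₀ h0.ne', one_smul] at this ⊢
  rw [this, finrank_euclideanSpace_fin, smul_smul, mul_inv_cancel₀ (by positivity), one_smul]

/-- `φ = χ(·/2) - χ` on the kernel side: a block is the difference of consecutive low frequency
cut-offs, so sums of blocks telescope. -/
theorem scaledConv_kernel (hχ : IsLittlewoodPaleyCutoff χ) (j : ℤ)
    {f : EuclideanSpace ℝ (Fin d) → G} (hf : Continuous f) (hfb : ∃ C, ∀ x, ‖f x‖ ≤ C)
    (x : EuclideanSpace ℝ (Fin d)) :
    scaledConv hχ.kernel j f x = scaledConv hχ.lowKernel (j + 1) f x -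
      scaledConv hχ.lowKernel j f x := by
  have h1 := integrable_scaledConv hχ.lowKernel.integrable (j + 1) hf hfb x
  have e : ∀ y : EuclideanSpace ℝ (Fin d), ((2 : ℝ) ^ d • hχ.lowKernel ((2 : ℝ) • y)) •
      f (x - (2 : ℝ) ^ (-j) • y) = (2 : ℝ) ^ d •
        (fun y => hχ.lowKernel y • f (x - (2 : ℝ) ^ (-(j + 1)) • y)) ((2 : ℝ) • y) := fun y => by
    rw [smul_assoc]
    simp only
    rw [smul_smul ((2 : ℝ) ^ (-(j + 1)))]
    congr 4
    rw [neg_add, zpow_add₀ two_ne_zero, zpow_neg_one, mul_assoc, inv_mul_cancel₀ two_ne_zero,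
      mul_one]
  have h2 : Integrable fun y : EuclideanSpace ℝ (Fin d) =>
      ((2 : ℝ) ^ d • hχ.lowKernel ((2 : ℝ) • y)) • f (x - (2 : ℝ) ^ (-j) • y) := by
    simp_rw [e]
    exact (h1.comp_smul two_ne_zero).smul _
  unfold scaledConv
  simp_rw [kernel_eq_sub, sub_smul]
  rw [integral_sub h2 (integrable_scaledConv hχ.lowKernel.integrable j hf hfb x)]
  congr 1
  simp_rw [e]
  have h3 := Measure.integral_comp_smul_of_nonneg (volume : Measure (EuclideanSpace ℝ (Fin d)))
    (fun y => hχ.lowKernel y • f (x - (2 : ℝ) ^ (-(j + 1)) • y)) 2 (hR := zero_le_two)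
  rw [integral_smul, h3, finrank_euclideanSpace_fin, smul_smul, mul_inv_cancel₀
      (by positivity), one_smul]

/-- Frequency localization as a fixed-point identity. The later estimates use it only in this form,
without any Fourier support. -/
theorem scaledConv_reproducingKernel [CompleteSpace G] (hχ : IsLittlewoodPaleyCutoff χ)
    (hd : 1 ≤ d) (j : ℤ) {f : EuclideanSpace ℝ (Fin d) → G} (hf : Continuous f)
    (hfb : ∃ C, ∀ x, ‖f x‖ ≤ C) :
    scaledConv hχ.reproducingKernel j (scaledConv hχ.kernel j f) = scaledConv hχ.kernel j f := by
  rw [scaledConv_scaledConv hχ.reproducingKernel.integrable hχ.kernel.integrable j hf hfb]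
  simp_rw [hχ.reproducingKernel_convolution hd]

end IsLittlewoodPaleyCutoff

end Cutoff

/-! ### Estimate for frequency localized functions -/

section Localized

variable {d : ℕ} {F : Type*} [NormedAddCommGroup F] [NormedSpace ℂ F] [CompleteSpace F]

/-- The Besov norm of the nonlocal term of two frequency localized functions. -/
theorem exists_tsum_nonlocalIntegral_le (hd : 1 ≤ d) {α s : ℝ} (hα : α ∈ Set.Ioo (1 : ℝ) 2)
    (hs : s ∈ Set.Ioo (0 : ℝ) 1) (g : 𝓢(EuclideanSpace ℝ (Fin d), ℂ))
    {h : 𝓢(EuclideanSpace ℝ (Fin d), ℂ)} (h0 : ∫ y, h y = 0) :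
    ∃ K : ℝ≥0∞, K ≠ ⊤ ∧ ∀ (p q r : ℝ≥0∞) [ENNReal.HolderTriple q p r] (_ : 1 ≤ p) (_ : 1 ≤ q)
      (_ : 1 ≤ r) (j k : ℤ) (u : EuclideanSpace ℝ (Fin d) → F)
      (U : EuclideanSpace ℝ (Fin d) → EuclideanSpace ℝ (Fin d) →L[ℝ] F)
      (σ : EuclideanSpace ℝ (Fin d) → ℂ)
      (S : EuclideanSpace ℝ (Fin d) → EuclideanSpace ℝ (Fin d) →L[ℝ] ℂ)
      (_ : IsBoundedC1 u U) (_ : IsBoundedC1 σ S) (_ : scaledConv g j U = U)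
      (_ : scaledConv g k σ = σ),
      ∑' l : ℤ, twoPow (l * s) * eLpNorm (scaledConv h l (nonlocalIntegral α u σ)) r volume ≤
        K * (twoPow ((max j k : ℤ) * s) * twoPow (k * (α - 1)) *
          (eLpNorm σ q volume * eLpNorm U p volume)) := by
  have : Nonempty (Fin d) := ⟨⟨0, hd⟩⟩
  obtain ⟨C, hCt, hC⟩ := g.exists_eLpNorm_finDiff_le
  set W := ∫⁻ y : EuclideanSpace ℝ (Fin d), singularWeight α 0 y with hW
  have hWt : W ≠ ⊤ := lintegral_singularWeight_zero_ne_top hα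
  set H := (∫⁻ y, ‖h y‖ₑ) + ∫⁻ y, ‖h y‖ₑ * ‖y‖ₑ with hH
  have hHt : H ≠ ⊤ := by
    refine ENNReal.add_ne_top.2 ⟨h.integrable.2.ne, ?_⟩
    have := (h.integrable_pow_mul volume 1).2.ne
    simpa [enorm_mul, mul_comm] using this
  set T := ∑' l : ℤ, twoPow (l * s) * min 1 (twoPow (-l)) with hT
  have hTt : T ≠ ⊤ := tsum_twoPow_mul_min_ne_top hs
  -- `W * (C + 2 * (C * C))` is one amplitude for both bounds: `W * C` suffices for the size, and `C
  -- * C` comes from each of the two Leibniz terms for the differences.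
  refine ⟨H * T * (W * (C + 2 * (C * C))), by finiteness, ?_⟩
  intro p q r _ hp hq hr j k u U σ S hu hσ hgU hgσ
  set N := eLpNorm σ q volume * eLpNorm U p volume with hN
  have hB : ∀ y, eLpNorm (finDiff y σ) q volume ≤
      C * eLpNorm σ q volume * min 1 ‖(2 : ℝ) ^ k • y‖ₑ := fun y => by
    have := eLpNorm_finDiff_scaledConv_le hC k hσ.continuous hσ.bdd hq y
    rw [hgσ] at this
    exact this.trans (le_of_eq (by ring))
  have hU : ∀ z, eLpNorm (finDiff z U) p volume ≤
      C * (twoPow (max j k : ℤ) * ‖z‖ₑ) * eLpNorm U p volume := fun z => by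
    have := eLpNorm_finDiff_scaledConv_le hC j hu.continuous_deriv hu.bdd_deriv hp z
    rw [hgU] at this
    refine this.trans ?_
    gcongr
    refine (min_le_right _ _).trans ?_
    rw [enorm_two_zpow_smul]
    gcongr
    exact twoPow_mono (by exact_mod_cast le_max_left j k)
  have hσz : ∀ z, eLpNorm (finDiff z σ) q volume ≤
      C * (twoPow (max j k : ℤ) * ‖z‖ₑ) * eLpNorm σ q volume := fun z => by
    refine (hB z).trans ?_
    rw [mul_right_comm]
    gcongr
    refine (min_le_right _ _).trans ?_
    rw [enorm_two_zpow_smul]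
    gcongr
    exact twoPow_mono (by exact_mod_cast le_max_right j k)
  -- Differences commute with convolution, so the difference of `σ` with step `z` is localized at
  -- frequency `2^k` too, and a second difference gains another factor.
  have hB' : ∀ z y, eLpNorm (finDiff y (finDiff z σ)) q volume ≤
      C * (C * (twoPow (max j k : ℤ) * ‖z‖ₑ) * eLpNorm σ q volume) *
        min 1 ‖(2 : ℝ) ^ k • y‖ₑ := fun z y => by
    have hz := hσ.finDiff z
    have := eLpNorm_finDiff_scaledConv_le hC k hz.continuous hz.bdd hq y
    rw [← finDiff_scaledConv g.integrable k hσ.continuous hσ.bdd z, hgσ] at this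
    refine this.trans ?_
    rw [mul_right_comm]
    gcongr
    exact hσz z
  have hA : eLpNorm (nonlocalIntegral α u σ) r volume ≤
      W * (C + 2 * (C * C)) * (twoPow (k * (α - 1)) * N) := by
    refine (eLpNorm_nonlocalIntegral_le α hu hσ.continuous hp hr k hB).trans ?_
    calc _ = W * C * (twoPow (k * (α - 1)) * N) := by rw [hN]; ring
      _ ≤ _ := by gcongr; exact le_self_add
  have hD : ∀ z, eLpNorm (finDiff z (nonlocalIntegral α u σ)) r volume ≤
      twoPow (max j k : ℤ) * (W * (C + 2 * (C * C)) * (twoPow (k * (α - 1)) * N)) * ‖z‖ₑ :=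
    fun z => by
    refine (eLpNorm_finDiff_nonlocalIntegral_le hd hα hu hσ hp hr k hB z (hB' z)).trans ?_
    calc _ ≤ twoPow (k * (α - 1)) * W * (C * eLpNorm σ q volume *
          (C * (twoPow (max j k : ℤ) * ‖z‖ₑ) * eLpNorm U p volume) +
          C * (C * (twoPow (max j k : ℤ) * ‖z‖ₑ) * eLpNorm σ q volume) * eLpNorm U p volume) := by
          gcongr
          exact hU z
      _ = twoPow (max j k : ℤ) * (W * (2 * (C * C)) * (twoPow (k * (α - 1)) * N)) * ‖z‖ₑ := by
          rw [hN]; ring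
      _ ≤ _ := by gcongr; exact le_add_self
  refine (tsum_eLpNorm_scaledConv_le h0
    (stronglyMeasurable_nonlocalIntegral α hu.continuous hσ.continuous)
    (exists_norm_nonlocalIntegral_le hd hα hu hσ) hr hA (max j k) hD s).trans (le_of_eq ?_)
  ring

/-- Bernstein with exponent equal to the dimension, so that `2^{jd/d} = 2^j`. -/
theorem exists_eLpNorm_top_le (hd : 1 ≤ d) (g : 𝓢(EuclideanSpace ℝ (Fin d), ℂ)) :
    ∃ N : ℝ≥0∞, N ≠ ⊤ ∧ ∀ {G : Type*} [NormedAddCommGroup G] [NormedSpace ℂ G] (j : ℤ)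
      (f : EuclideanSpace ℝ (Fin d) → G) (_ : Continuous f) (_ : scaledConv g j f = f),
      eLpNorm f ⊤ volume ≤ N * (twoPow j * eLpNorm f d volume) := by
  have hd1 : (1 : ℝ≥0∞) ≤ d := by exact_mod_cast hd
  have : Fact ((1 : ℝ≥0∞) ≤ d) := ⟨hd1⟩
  refine ⟨eLpNorm g (ENNReal.conjExponent d) volume, (g.memLp _ _).eLpNorm_lt_top.ne, ?_⟩
  intro G _ _ j f hf hgf
  rw [eLpNorm_exponent_top]
  refine eLpNormEssSup_le_of_ae_enorm_bound (Eventually.of_forall fun x => ?_)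
  have := enorm_scaledConv_le_eLpNorm (p := d) (q := ENNReal.conjExponent d) g.continuous j hf
    (ENNReal.natCast_ne_top d) x
  rw [hgf] at this
  refine this.trans (le_of_eq ?_)
  congr 2
  rw [finrank_euclideanSpace_fin, zpow_mul, zpow_natCast, ENNReal.ofReal_pow (by positivity),
    ofReal_two_zpow, ← ENNReal.rpow_natCast, ← ENNReal.rpow_mul]
  have : (d : ℝ) ≠ 0 := by positivity
  simp [this]

theorem exists_tsum_nonlocalIntegral_le_twoPow (hd : 1 ≤ d) {α θ : ℝ}
    (hα : α ∈ Set.Ioo (1 : ℝ) 2) (hθ0 : 0 ≤ θ) (hθ1 : θ ≤ α - 1)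
    (g : 𝓢(EuclideanSpace ℝ (Fin d), ℂ))
    {h : 𝓢(EuclideanSpace ℝ (Fin d), ℂ)} (h0 : ∫ y, h y = 0) :
    ∃ K : ℝ≥0∞, K ≠ ⊤ ∧ ∀ (j k : ℤ) (u : EuclideanSpace ℝ (Fin d) → F)
      (U : EuclideanSpace ℝ (Fin d) → EuclideanSpace ℝ (Fin d) →L[ℝ] F)
      (σ : EuclideanSpace ℝ (Fin d) → ℂ)
      (S : EuclideanSpace ℝ (Fin d) → EuclideanSpace ℝ (Fin d) →L[ℝ] ℂ)
      (_ : IsBoundedC1 u U) (_ : IsBoundedC1 σ S) (_ : scaledConv g j U = U)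
      (_ : scaledConv g k σ = σ),
      ∑' l : ℤ, twoPow (l * (2 - α)) *
        eLpNorm (scaledConv h l (nonlocalIntegral α u σ)) d volume ≤
        K * ((twoPow (j * (1 - θ)) * eLpNorm U d volume) *
          (twoPow (k * (1 + θ)) * eLpNorm σ d volume)) := by
  have hd1 : (1 : ℝ≥0∞) ≤ d := by exact_mod_cast hd
  have hs : 2 - α ∈ Set.Ioo (0 : ℝ) 1 := ⟨by linarith [hα.2], by linarith [hα.1]⟩
  obtain ⟨K, hKt, hK⟩ := exists_tsum_nonlocalIntegral_le (F := F) hd hα hs g h0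
  obtain ⟨N, hNt, hN⟩ := exists_eLpNorm_top_le hd g
  obtain ⟨N', hNt', hN'⟩ := exists_eLpNorm_top_le hd g
  refine ⟨K * (N + N'), by finiteness, ?_⟩
  intro j k u U σ S hu hσ hgU hgσ
  rcases le_total j k with hjk | hkj
  · refine (hK ⊤ d d le_top hd1 hd1 j k u U σ S hu hσ hgU hgσ).trans ?_
    rw [max_eq_right hjk]
    have hjk' : (j : ℝ) ≤ k := by exact_mod_cast hjk
    calc _ ≤ K * (twoPow (k * (2 - α)) * twoPow (k * (α - 1)) *
          (eLpNorm σ d volume * (N * (twoPow j * eLpNorm U d volume)))) := by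
          gcongr
          exact hN j U hu.continuous_deriv hgU
      _ = K * N * (twoPow (k * (2 - α) + k * (α - 1) + j) *
          (eLpNorm U d volume * eLpNorm σ d volume)) := by
          rw [twoPow_add, twoPow_add]; ring
      _ ≤ K * (N + N') * (twoPow (j * (1 - θ) + k * (1 + θ)) *
          (eLpNorm U d volume * eLpNorm σ d volume)) := by
          gcongr
          · exact le_self_add
          · refine twoPow_mono ?_
            -- The exponents differ by `θ (k - j)`.
            nlinarith [mul_le_mul_of_nonneg_left hjk' hθ0]
      _ = _ := by rw [twoPow_add]; ring
  · refine (hK d ⊤ d hd1 le_top hd1 j k u U σ S hu hσ hgU hgσ).trans ?_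
    rw [max_eq_left hkj]
    have hkj' : (k : ℝ) ≤ j := by exact_mod_cast hkj
    calc _ ≤ K * (twoPow (j * (2 - α)) * twoPow (k * (α - 1)) *
          (N' * (twoPow k * eLpNorm σ d volume) * eLpNorm U d volume)) := by
          gcongr
          exact hN' k σ hσ.continuous hgσ
      _ = K * N' * (twoPow (j * (2 - α) + k * (α - 1) + k) *
          (eLpNorm U d volume * eLpNorm σ d volume)) := by
          rw [twoPow_add, twoPow_add]; ring
      _ ≤ K * (N + N') * (twoPow (j * (1 - θ) + k * (1 + θ)) *
          (eLpNorm U d volume * eLpNorm σ d volume)) := by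
          gcongr
          · exact le_add_self
          · refine twoPow_mono ?_
            -- The exponents differ by `(α - 1 - θ) (j - k)`.
            nlinarith [mul_le_mul_of_nonneg_left hkj' (sub_nonneg.2 hθ1)]
      _ = _ := by rw [twoPow_add]; ring

end Localized

/-! ### Littlewood-Paley decomposition of the nonlocal term -/

section Decomposition

variable {d : ℕ} {χ : EuclideanSpace ℝ (Fin d) → ℝ} {F : Type*} [NormedAddCommGroup F]
  [NormedSpace ℂ F] {G : Type*} [NormedAddCommGroup G] [NormedSpace ℂ G]

/-- The Littlewood-Paley partial sum `∑ -n ≤ j < n, Δ_j f`. -/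
noncomputable def IsLittlewoodPaleyCutoff.partialSum (hχ : IsLittlewoodPaleyCutoff χ) (n : ℕ)
    (f : EuclideanSpace ℝ (Fin d) → G) (x : EuclideanSpace ℝ (Fin d)) : G :=
  scaledConv hχ.lowKernel n f x - scaledConv hχ.lowKernel (-n) f x

namespace IsLittlewoodPaleyCutoff

theorem partialSum_eq_sum (hχ : IsLittlewoodPaleyCutoff χ) (n : ℕ)
    {f : EuclideanSpace ℝ (Fin d) → G} (hf : Continuous f) (hfb : ∃ C, ∀ x, ‖f x‖ ≤ C)
    (x : EuclideanSpace ℝ (Fin d)) :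
    hχ.partialSum n f x = ∑ j ∈ Finset.Ico (-(n : ℤ)) n, scaledConv hχ.kernel j f x := by
  simp_rw [hχ.scaledConv_kernel _ hf hfb]
  exact (sum_Ico_neg_sub (fun j => scaledConv hχ.lowKernel j f x) n).symm

theorem isBoundedC1_partialSum (hχ : IsLittlewoodPaleyCutoff χ) (n : ℕ)
    {w : EuclideanSpace ℝ (Fin d) → G}
    {W : EuclideanSpace ℝ (Fin d) → EuclideanSpace ℝ (Fin d) →L[ℝ] G}
    (h : IsBoundedC1 w W) : IsBoundedC1 (hχ.partialSum n w) (hχ.partialSum n W) :=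
  (h.scaledConv hχ.lowKernel.integrable n).sub (h.scaledConv hχ.lowKernel.integrable (-n))

theorem norm_partialSum_le (hχ : IsLittlewoodPaleyCutoff χ) (n : ℕ)
    {f : EuclideanSpace ℝ (Fin d) → G} {C : ℝ} (hC : ∀ x, ‖f x‖ ≤ C)
    (x : EuclideanSpace ℝ (Fin d)) :
    ‖hχ.partialSum n f x‖ ≤ (∫ y, ‖hχ.lowKernel y‖) * C + (∫ y, ‖hχ.lowKernel y‖) * C :=
  (norm_sub_le _ _).trans (add_le_add (norm_scaledConv_le hχ.lowKernel.integrable n hC x)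
    (norm_scaledConv_le hχ.lowKernel.integrable (-n) hC x))

theorem tendsto_partialSum [CompleteSpace G] (hχ : IsLittlewoodPaleyCutoff χ) (hd : 1 ≤ d)
    {f : EuclideanSpace ℝ (Fin d) → G} (hf : Continuous f) (hfb : ∃ C, ∀ x, ‖f x‖ ≤ C)
    (hfi : Integrable f) (x : EuclideanSpace ℝ (Fin d)) :
    Tendsto (fun n => hχ.partialSum n f x) atTop (𝓝 (f x)) := by
  have : Nonempty (Fin d) := ⟨⟨0, hd⟩⟩
  have h1 := (tendsto_scaledConv_atTop hχ.lowKernel (hχ.integral_lowKernel hd) hf hfb x).comp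
    tendsto_natCast_atTop_atTop
  have h2 := (tendsto_scaledConv_atBot hχ.lowKernel hfi x).comp
    (tendsto_neg_atTop_atBot.comp tendsto_natCast_atTop_atTop)
  unfold partialSum
  simpa using h1.sub h2

end IsLittlewoodPaleyCutoff

theorem nonlocalIntegral_sum (hd : 1 ≤ d) {α : ℝ} (hα : α ∈ Set.Ioo (1 : ℝ) 2) {ι κ : Type*}
    (s : Finset ι) (t : Finset κ) {u : ι → EuclideanSpace ℝ (Fin d) → F}
    {U : ι → EuclideanSpace ℝ (Fin d) → EuclideanSpace ℝ (Fin d) →L[ℝ] F}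
    {σ : κ → EuclideanSpace ℝ (Fin d) → ℂ}
    {S : κ → EuclideanSpace ℝ (Fin d) → EuclideanSpace ℝ (Fin d) →L[ℝ] ℂ}
    (hu : ∀ i, IsBoundedC1 (u i) (U i)) (hσ : ∀ i, IsBoundedC1 (σ i) (S i))
    (x : EuclideanSpace ℝ (Fin d)) :
    nonlocalIntegral α (fun x => ∑ i ∈ s, u i x) (fun x => ∑ i ∈ t, σ i x) x =
      ∑ i ∈ s, ∑ k ∈ t, nonlocalIntegral α (u i) (σ k) x := by
  unfold nonlocalIntegral
  have hi : ∀ i k, Integrable (nonlocalIntegrand α (u i) (σ k) x) := fun i k =>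
    integrable_nonlocalIntegrand hd hα (hu i) (hσ k) x
  simp_rw [← integral_finsetSum t fun k _ => hi _ k]
  rw [← integral_finsetSum s fun i _ => integrable_finsetSum t fun k _ => hi i k]
  congr 1; funext y
  simp only [nonlocalIntegrand, ← Finset.sum_sub_distrib, Finset.smul_sum, Finset.sum_smul]

theorem scaledConv_sum (k : 𝓢(EuclideanSpace ℝ (Fin d), ℂ)) (l : ℤ) {ι : Type*} (s : Finset ι)
    {f : ι → EuclideanSpace ℝ (Fin d) → G} (hf : ∀ i, StronglyMeasurable (f i))
    (hfb : ∀ i, ∃ C, ∀ x, ‖f i x‖ ≤ C) (x : EuclideanSpace ℝ (Fin d)) :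
    scaledConv k l (fun x => ∑ i ∈ s, f i x) x = ∑ i ∈ s, scaledConv k l (f i) x := by
  unfold scaledConv
  rw [← integral_finsetSum s fun i _ => ?_]
  · simp only [Finset.smul_sum]
  · obtain ⟨C, hC⟩ := hfb i
    have hm : StronglyMeasurable fun y => f i (x - (2 : ℝ) ^ (-l) • y) :=
      (hf i).comp_measurable (by fun_prop)
    exact k.integrable.smul_bdd C hm.aestronglyMeasurable (Eventually.of_forall fun y => hC _)

/-- Dominated convergence for the nonlocal term. -/
theorem tendsto_nonlocalIntegral (hd : 1 ≤ d) {α : ℝ} (hα : α ∈ Set.Ioo (1 : ℝ) 2)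
    {u : EuclideanSpace ℝ (Fin d) → F} {σ : EuclideanSpace ℝ (Fin d) → ℂ}
    {un : ℕ → EuclideanSpace ℝ (Fin d) → F} {σn : ℕ → EuclideanSpace ℝ (Fin d) → ℂ} {A B : ℝ}
    (hun : ∀ n, Continuous (un n)) (hσn : ∀ n, Continuous (σn n))
    (hA : ∀ n x y, ‖un n (x + y) - un n x‖ ≤ A * ‖y‖)
    (hB : ∀ n x y, ‖σn n (x + y) - σn n x‖ ≤ B * min 1 ‖y‖)
    (hu : ∀ x, Tendsto (fun n => un n x) atTop (𝓝 (u x)))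
    (hσ : ∀ x, Tendsto (fun n => σn n x) atTop (𝓝 (σ x))) (x : EuclideanSpace ℝ (Fin d)) :
    Tendsto (fun n => nonlocalIntegral α (un n) (σn n) x) atTop
      (𝓝 (nonlocalIntegral α u σ x)) := by
  refine tendsto_integral_of_dominated_convergence _
    (fun n => ((stronglyMeasurable_nonlocalIntegrand α (hun n) (hσn n)).comp_measurable
      measurable_prodMk_left).aestronglyMeasurable)
    ((integrable_norm_weight hd hα).const_mul (B * A))
    (fun n => Eventually.of_forall (norm_nonlocalIntegrand_le α (hA n x) (hB n x)))
    (Eventually.of_forall fun y => ?_)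
  exact (((hσ _).sub (hσ _)).smul ((hu _).sub (hu _))).const_smul _

/-- Dominated convergence for a rescaled convolution. -/
theorem tendsto_scaledConv_of_bound (k : 𝓢(EuclideanSpace ℝ (Fin d), ℂ)) (l : ℤ)
    {f : EuclideanSpace ℝ (Fin d) → G} {fn : ℕ → EuclideanSpace ℝ (Fin d) → G} {C : ℝ}
    (hm : ∀ n, StronglyMeasurable (fn n)) (hC : ∀ n x, ‖fn n x‖ ≤ C)
    (hf : ∀ x, Tendsto (fun n => fn n x) atTop (𝓝 (f x))) (x : EuclideanSpace ℝ (Fin d)) :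
    Tendsto (fun n => scaledConv k l (fn n) x) atTop (𝓝 (scaledConv k l f x)) := by
  refine tendsto_integral_of_dominated_convergence (fun y => ‖k y‖ * C) (fun n => ?_)
    (k.integrable.norm.mul_const C) (fun n => Eventually.of_forall fun y => ?_)
    (Eventually.of_forall fun y => (hf _).const_smul _)
  · exact ((stronglyMeasurable_scaledConv_integrand k.continuous l (hm n)).comp_measurable
      measurable_prodMk_left).aestronglyMeasurable
  · rw [norm_smul]
    exact mul_le_mul_of_nonneg_left (hC _ _) (norm_nonneg _)

/-- For partial sums this is finite bilinearity and the triangle inequality. Their sup and Lipschitz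
bounds do not depend on `n`, so dominated convergence applies twice, in the nonlocal integral and in
the convolution. -/
theorem eLpNorm_scaledConv_nonlocalIntegral_le [CompleteSpace F]
    (hχ : IsLittlewoodPaleyCutoff χ) (hd : 1 ≤ d)
    {α : ℝ} (hα : α ∈ Set.Ioo (1 : ℝ) 2) (h : 𝓢(EuclideanSpace ℝ (Fin d), ℂ))
    {u : EuclideanSpace ℝ (Fin d) → F}
    {U : EuclideanSpace ℝ (Fin d) → EuclideanSpace ℝ (Fin d) →L[ℝ] F}
    {σ : EuclideanSpace ℝ (Fin d) → ℂ}
    {S : EuclideanSpace ℝ (Fin d) → EuclideanSpace ℝ (Fin d) →L[ℝ] ℂ}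
    (hu : IsBoundedC1 u U) (hσ : IsBoundedC1 σ S) (hui : Integrable u) (hσi : Integrable σ)
    {p : ℝ≥0∞} (hp : 1 ≤ p) (l : ℤ) :
    eLpNorm (scaledConv h l (nonlocalIntegral α u σ)) p volume ≤
      ∑' (j : ℤ) (k : ℤ), eLpNorm (scaledConv h l (nonlocalIntegral α
        (scaledConv hχ.kernel j u) (scaledConv hχ.kernel k σ))) p volume := by
  obtain ⟨A, hA⟩ := hu.bdd_deriv
  obtain ⟨B, hB⟩ := hσ.bdd
  obtain ⟨B', hB'⟩ := hσ.bdd_deriv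
  set κ := ∫ y, ‖hχ.lowKernel y‖
  have hun := fun n => hχ.isBoundedC1_partialSum n hu
  have hσn := fun n => hχ.isBoundedC1_partialSum n hσ
  have huj := fun j => hu.scaledConv hχ.kernel.integrable j
  have hσk := fun k => hσ.scaledConv hχ.kernel.integrable k
  have bA : ∀ n x y, ‖hχ.partialSum n u (x + y) - hχ.partialSum n u x‖ ≤
      (κ * A + κ * A) * ‖y‖ := fun n =>
    (hun n).norm_sub_le_of_bound (hχ.norm_partialSum_le n hA)
  have bB : ∀ n x y, ‖hχ.partialSum n σ (x + y) - hχ.partialSum n σ x‖ ≤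
      max ((κ * B + κ * B) + (κ * B + κ * B)) (κ * B' + κ * B') * min 1 ‖y‖ := fun n =>
    (hσn n).norm_sub_le_min (hχ.norm_partialSum_le n hB) (hχ.norm_partialSum_le n hB')
  have hm := fun n => stronglyMeasurable_nonlocalIntegral α (hun n).continuous (hσn n).continuous
  have hmjk := fun q : ℤ × ℤ =>
    stronglyMeasurable_nonlocalIntegral α (huj q.1).continuous (hσk q.2).continuous
  have hlim := tendsto_nonlocalIntegral hd hα (fun n => (hun n).continuous)
    (fun n => (hσn n).continuous) bA bB (hχ.tendsto_partialSum hd hu.continuous hu.bdd hui)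
    (hχ.tendsto_partialSum hd hσ.continuous hσ.bdd hσi)
  have hb := fun n x => norm_integral_le_of_norm_le
    ((integrable_norm_weight hd hα).const_mul _) (Eventually.of_forall
      (norm_nonlocalIntegrand_le α (bA n x) (bB n x)))
  -- Fatou's lemma: a bound uniform in `n` passes to the pointwise limit.
  refine Lp.eLpNorm_le_of_ae_tendsto (Eventually.of_forall fun n => ?_)
    (fun n => (stronglyMeasurable_scaledConv h.continuous l (hm n)).aestronglyMeasurable)
    (Eventually.of_forall (tendsto_scaledConv_of_bound h l hm hb hlim))
  have e : scaledConv h l (nonlocalIntegral α (hχ.partialSum n u) (hχ.partialSum n σ)) =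
      ∑ q ∈ Finset.Ico (-(n : ℤ)) n ×ˢ Finset.Ico (-(n : ℤ)) n,
        scaledConv h l (nonlocalIntegral α (scaledConv hχ.kernel q.1 u)
          (scaledConv hχ.kernel q.2 σ)) := by
    funext x
    rw [Finset.sum_apply, ← scaledConv_sum h l _ hmjk fun q =>
      exists_norm_nonlocalIntegral_le hd hα (huj q.1) (hσk q.2)]
    congr 1; funext x
    rw [show hχ.partialSum n u = _ from funext (hχ.partialSum_eq_sum n hu.continuous hu.bdd),
      show hχ.partialSum n σ = _ from funext (hχ.partialSum_eq_sum n hσ.continuous hσ.bdd),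
      nonlocalIntegral_sum hd hα _ _ huj hσk, Finset.sum_product]
  rw [e]
  refine (eLpNorm_sum_le (fun q _ =>
    (stronglyMeasurable_scaledConv h.continuous l (hmjk q)).aestronglyMeasurable) hp).trans ?_
  refine (ENNReal.sum_le_tsum _).trans (le_of_eq ?_)
  exact ENNReal.tsum_prod (f := fun j k => eLpNorm (scaledConv h l (nonlocalIntegral α
    (scaledConv hχ.kernel j u) (scaledConv hχ.kernel k σ))) p volume)

end Decomposition

theorem mainTheorem2 {d : ℕ} (hd : 1 ≤ d)
    {F : Type*} [NormedAddCommGroup F] [NormedSpace ℂ F] [FiniteDimensional ℂ F]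
    (χ : EuclideanSpace ℝ (Fin d) → ℝ) (hχ : IsLittlewoodPaleyCutoff χ)
    (α θ : ℝ) (hα : α ∈ Set.Ioo (1 : ℝ) 2) (hθ : θ ∈ Set.Icc (0 : ℝ) (min (2 - α) (α - 1))) :
    ∃ K : ℝ, 0 < K ∧
      ∀ (u : 𝓢(EuclideanSpace ℝ (Fin d), F)) (σ : 𝓢(EuclideanSpace ℝ (Fin d), ℂ)),
        (∀ x, HasPrincipalValue (nonlocalIntegrand α u σ x) (nonlocalTerm α u σ x)) ∧
        besovNorm χ (2 - α) (d : ℝ≥0∞) (nonlocalTerm α u σ) ≤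
          ENNReal.ofReal K * besovNorm χ (1 - θ) (d : ℝ≥0∞) (fderiv ℝ u) *
            besovNorm χ (1 + θ) (d : ℝ≥0∞) σ := by
  have : CompleteSpace F := FiniteDimensional.complete ℂ F
  have hd1 : (1 : ℝ≥0∞) ≤ d := by exact_mod_cast hd
  obtain ⟨K, hKt, hK⟩ := exists_tsum_nonlocalIntegral_le_twoPow (F := F) hd hα hθ.1
    (hθ.2.trans (min_le_right _ _)) hχ.reproducingKernel hχ.integral_kernel
  -- `K` may be 0; adding 1 makes the constant strictly positive.
  refine ⟨K.toReal + 1, by positivity, fun u σ => ?_⟩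
  have hu := u.isBoundedC1
  have hσ := σ.isBoundedC1
  rw [nonlocalTerm_eq_nonlocalIntegral hd hα hu hσ]
  refine ⟨hasPrincipalValue_nonlocalIntegral hd hα hu hσ, ?_⟩
  have hK' : K ≤ ENNReal.ofReal (K.toReal + 1) :=
    ENNReal.le_ofReal_iff_toReal_le hKt (by positivity) |>.2 (by linarith)
  simp only [besovNorm, hχ.dyadicBlock_eq_scaledConv]
  change ∑' l : ℤ, twoPow (l * (2 - α)) *
      eLpNorm (scaledConv hχ.kernel l (nonlocalIntegral α u σ)) d volume ≤
    _ * (∑' j : ℤ, twoPow (j * (1 - θ)) *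
      eLpNorm (scaledConv hχ.kernel j (fderiv ℝ u)) d volume) *
    ∑' k : ℤ, twoPow (k * (1 + θ)) * eLpNorm (scaledConv hχ.kernel k σ) d volume
  calc _ ≤ ∑' l : ℤ, twoPow (l * (2 - α)) * ∑' (j : ℤ) (k : ℤ),
        eLpNorm (scaledConv hχ.kernel l (nonlocalIntegral α
          (scaledConv hχ.kernel j u) (scaledConv hχ.kernel k σ))) d volume := by
        gcongr with l
        exact eLpNorm_scaledConv_nonlocalIntegral_le hχ hd hα hχ.kernel hu hσ u.integrable
          σ.integrable hd1 l
    -- With the sum over `l` innermost, the localized estimate applies to each pair `(j, k)`.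
    _ = ∑' (j : ℤ) (k : ℤ) (l : ℤ), twoPow (l * (2 - α)) *
        eLpNorm (scaledConv hχ.kernel l (nonlocalIntegral α
          (scaledConv hχ.kernel j u) (scaledConv hχ.kernel k σ))) d volume := by
        simp_rw [← ENNReal.tsum_mul_left]
        rw [ENNReal.tsum_comm]
        congr 1; funext j
        rw [ENNReal.tsum_comm]
    _ ≤ ∑' (j : ℤ) (k : ℤ), K * ((twoPow (j * (1 - θ)) *
          eLpNorm (scaledConv hχ.kernel j (fderiv ℝ u)) d volume) *
        (twoPow (k * (1 + θ)) * eLpNorm (scaledConv hχ.kernel k σ) d volume)) := by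
        gcongr with j k
        exact hK j k _ _ _ _ (hu.scaledConv hχ.kernel.integrable j)
          (hσ.scaledConv hχ.kernel.integrable k)
          (hχ.scaledConv_reproducingKernel hd j hu.continuous_deriv hu.bdd_deriv)
          (hχ.scaledConv_reproducingKernel hd k hσ.continuous hσ.bdd)
    _ = K * (∑' j : ℤ, twoPow (j * (1 - θ)) *
          eLpNorm (scaledConv hχ.kernel j (fderiv ℝ u)) d volume) *
        ∑' k : ℤ, twoPow (k * (1 + θ)) * eLpNorm (scaledConv hχ.kernel k σ) d volume := by
        simp_rw [ENNReal.tsum_mul_left, ENNReal.tsum_mul_right]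
        rw [mul_assoc]
    _ ≤ _ := by gcongr
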